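/- Let $q\in\mathbb{C}$ with $0<|q|<1$. Write $(x;q)_\infty=\prod_{i\ge 0}(1-xq^i)$, $(q)_\infty=(q;q)_\infty$, $\Theta(x;q)=(x;q)_\infty(q/x;q)_\infty(q;q)_\infty$, and $$m(x,z;q)=\frac{1}{\Theta(z;q)}\sum_{r\in\mathbb{Z}}\frac{(-1)^r q^{\binom r2}z^r}{1-q^{r-1}xz}.$$ Let $\operatorname{sg}(r)=1$ for $r\ge 0$, $\operatorname{sg}(r)=-1$ for $r<0$, and $\operatorname{sg}(r,s)=\tfrac12(\operatorname{sg}(r)+\operatorname{sg}(s))$. For fixed $t\in\mathbb{N}$ and $p,m\in\mathbb{Z}$ put $$B_{p,m}(r,s)=\tfrac{r^2}{8}+\tfrac{4t-1}{4}rs+\tfrac{s^2}{8}+\tfrac{4p-1-2m}{4}r+\tfrac{1+2m}{4}s,\qquad \theta_{p,m}=\sum_{r\equiv s\,(\mathrm{mod}\ 2)}\operatorname{sg}(r,s)(-1)^{\frac{r-s}{2}}q^{B_{p,m}(r,s)},$$ where the sum is over pairs of integers ($B_{p,m}(r,s)$ is an integer when $r\equiv s \pmod 2$), and $$f_{t,m}(x)=\frac{\Theta(x;q)}{(q)_\infty^3}\sum_{r\equiv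 s\,(\mathrm{mod}\ 2)}\operatorname{sg}(r,s)\frac{(-1)^{\frac{r-s}{2}}q^{B_{t,m}(r,s)}}{1-xq^{\frac{r+s}{2}}}.$$ **Theorem.** Let $t\ge 2$ and $1\le m<t$ be integers, and let $x\in\mathbb{C}\setminus\{0\}$ be such that $x^{2t-1}\neq -q^{(2t-1)n}$ and $x^{2t}\ne q^n$ for all $n\in\mathbb{Z}$ (that is, $\Theta(-x^{2t-1};q^{2t-1})\ne0$ and $\Theta(q^sx^{2t};q^{2t})\neq 0$ for $0\le s\le 2t-1$). Then all series above and below converge absolutely, no denominator vanishes, and $$\begin{aligned} f_{t,m}(x)={}&x^{-2t+m+1}\,m\!\left(x^{-2t+1}q^{m},-x^{2t-1};q^{2t-1}\right)+x^{-m}\,m\!\left(x^{-2t+1}q^{2t-1-m},-x^{2t-1};q^{2t-1}\right)\\ &-\frac{x^{-2t}}{\Theta(-x^{2t-1};q^{2t-1})\,(q)_\infty^3}\sum_{k=0}^{2t-1}x^kq^k\,\theta_{t+k,m+k}\\ &\quad\times\sum_{s=0}^{2t-1}(-1)^sq^{\binom s2}\,\Theta\!\left(q^{(2t-1)(t-s)};q^{2t(2t-1)}\right)x^s\,\Theta\!\left(q^sx^{2t};q^{2t}\right)m\!\left(-q^kx^{-2t},q^sx^{2t};q^{2t}\right).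 \end{aligned}$$ -/

import Mathlib

noncomputable section

/-- The infinite `q`-Pochhammer symbol `(x; q)_∞ = ∏_{i ≥ 0} (1 - x q ^ i)`. -/
def qPochInf (x q : ℂ) : ℂ := ∏' i : ℕ, (1 - x * q ^ i)

/-- For `|q| < 1` the product defining `(x; q)_∞` converges unconditionally. -/
theorem multipliable_qPochInf (x : ℂ) {q : ℂ} (hq : ‖q‖ < 1) :
    Multipliable fun i : ℕ => 1 - x * q ^ i := by
  have h : Summable fun i : ℕ => ‖-(x * q ^ i)‖ := by
    simp only [norm_neg, norm_mul, norm_pow]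
    exact (summable_geometric_of_lt_one (norm_nonneg q) hq).mul_left _
  simpa [sub_eq_add_neg] using multipliable_one_add_of_summable h

/-- The theta function `Θ(x; q) = (x; q)_∞ (q / x; q)_∞ (q; q)_∞`. -/
def bigTheta (x q : ℂ) : ℂ := qPochInf x q * qPochInf (q / x) q * qPochInf q q

/-- The sign convention `sg(r) = 1` for `r ≥ 0` and `sg(r) = -1` for `r < 0`. -/
def sg (r : ℤ) : ℂ := if 0 ≤ r then 1 else -1

/-- `sg(r, s) = (sg(r) + sg(s)) / 2`. -/
def sg₂ (r s : ℤ) : ℂ := (sg r + sg s) / 2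

/-- The pairs of integers `(r, s)` with `r ≡ s (mod 2)`. -/
abbrev EvenPair : Type := {v : ℤ × ℤ // v.1 ≡ v.2 [ZMOD 2]}

/-- Eight times the exponent
`r²/8 + (4t-1)rs/4 + s²/8 + (4p-1-2m)r/4 + (1+2m)s/4`. -/
def eightB (t p m r s : ℤ) : ℤ :=
  r ^ 2 + 2 * (4 * t - 1) * (r * s) + s ^ 2 + 2 * (4 * p - 1 - 2 * m) * r + 2 * (1 + 2 * m) * s

/-- The exponent is an integer whenever `r ≡ s (mod 2)`. -/
theorem eight_dvd_eightB (t p m : ℤ) {r s : ℤ} (h : r ≡ s [ZMOD 2]) :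
    8 ∣ eightB t p m r s := by
  obtain ⟨c, hc⟩ := h.dvd
  obtain rfl : s = r + 2 * c := by linarith
  obtain ⟨d, hd⟩ := Int.even_mul_succ_self c
  refine ⟨t * r ^ 2 + 2 * t * r * c + d + p * r + m * c, ?_⟩
  unfold eightB
  linear_combination 4 * hd

/-- The exponent `B_{p,m}(r,s) = r²/8 + (4t-1)rs/4 + s²/8 + (4p-1-2m)r/4 + (1+2m)s/4`,
used only for `r ≡ s (mod 2)`, where the division by `8` is exact. -/
def expB (t p m r s : ℤ) : ℤ := eightB t p m r s / 8

/-- For `r ≡ s (mod 2)`, `expB` is the rational exponent it stands for. -/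
theorem expB_eq (t p m : ℤ) {r s : ℤ} (h : r ≡ s [ZMOD 2]) :
    (expB t p m r s : ℚ) = (r : ℚ) ^ 2 / 8 + (4 * t - 1) / 4 * (r * s) + (s : ℚ) ^ 2 / 8
      + (4 * p - 1 - 2 * m) / 4 * r + (1 + 2 * m) / 4 * s := by
  have h8 : 8 * expB t p m r s = eightB t p m r s :=
    Int.mul_ediv_cancel' (eight_dvd_eightB t p m h)
  have h8' : (8 : ℚ) * (expB t p m r s : ℚ) = (eightB t p m r s : ℚ) := by exact_mod_cast h8
  unfold eightB at h8'
  push_cast at h8'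
  linear_combination h8' / 8

/-- The summand `sg(r,s) (-1)^{(r-s)/2} q^{B_{p,m}(r,s)}`; `(r-s)/2` is an integer as
`r ≡ s (mod 2)`. -/
def thetaTerm (t : ℕ) (p m : ℤ) (q : ℂ) (v : EvenPair) : ℂ :=
  sg₂ v.1.1 v.1.2 * (-1) ^ ((v.1.1 - v.1.2) / 2) * q ^ expB t p m v.1.1 v.1.2

/-- The indefinite binary theta series `θ_{p,m}` (for fixed `t`). -/
def thetaPM (t : ℕ) (p m : ℤ) (q : ℂ) : ℂ := ∑' v : EvenPair, thetaTerm t p m q v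

/-- The summand of `g_{t,m}(x)`; its exponent of `q` is `B_{t,m}(r,s)`, and `(r+s)/2` is an
integer as `r ≡ s (mod 2)`. -/
def gTerm (t : ℕ) (m : ℤ) (x q : ℂ) (v : EvenPair) : ℂ :=
  sg₂ v.1.1 v.1.2 *
    ((-1) ^ ((v.1.1 - v.1.2) / 2) * q ^ expB t t m v.1.1 v.1.2 /
      (1 - x * q ^ ((v.1.1 + v.1.2) / 2)))

/-- The Hecke–Appell-type sum `g_{t,m}(x)`. -/
def gTM (t : ℕ) (m : ℤ) (x q : ℂ) : ℂ := ∑' v : EvenPair, gTerm t m x q v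

/-- `f_{t,m}(x) = Θ(x; q) / (q; q)_∞³ · g_{t,m}(x)`. -/
def fTM (t : ℕ) (m : ℤ) (x q : ℂ) : ℂ := bigTheta x q / qPochInf q q ^ 3 * gTM t m x q

/-- The summand `(-1)^r q^{r(r-1)/2} z^r / (1 - q^{r-1} x z)` of the Appell function. -/
def appellTerm (x z q : ℂ) (r : ℤ) : ℂ :=
  (-1) ^ r * q ^ (r * (r - 1) / 2) * z ^ r / (1 - q ^ (r - 1) * x * z)

/-- The Appell function `m(x, z; q)`. -/
def appellM (x z q : ℂ) : ℂ := 1 / bigTheta z q * ∑' r : ℤ, appellTerm x z q r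

/-- The expression defining `m(x, z; q)` is meaningful: no denominator vanishes and the series
converges absolutely. -/
def AppellDefined (x z q : ℂ) : Prop :=
  bigTheta z q ≠ 0 ∧ (∀ r : ℤ, 1 - q ^ (r - 1) * x * z ≠ 0) ∧ Summable (appellTerm x z q)

end

noncomputable section

open Filter Topology

/-! Write `G` for the continuation of `Θ(x;q) g_{t,m}(x)` to all `x ≠ 0`, and `T(x) = Θ(-x^{2t-1};
q^{2t-1})`. In half-sum and half-difference coordinates `(n, j)` the Hecke sum becomes a series over
`n` of coefficients divided by `1 - x q^n`. Shifting `n` by one changes the sign factor only at `j =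
±n`. These boundary terms form level-one Appell sums, which equal monomials in `x` times `(q)_∞^3`
once multiplied by `Θ(x;q)`. Hence `G(qx) = -x^{2t-1} G(x)` plus explicit terms: two monomials, and
`Θ(x;q)` times a polynomial whose coefficients are the values `θ_{t+k,m+k}`
(`thetaAppell_heckeRow_mul_left`).

Since `T(qx) = x^{-(2t-1)} T(x)`, the product `T G` satisfies `F(qx) + F(x) = R(x)` with `R` known.
Dividing each Laurent coefficient of `R` by `1 + q^N` gives a particular solution. On theta series
this division produces Appell functions (`appellLaurent_mul_left_add`, `appellLaurent_eq`). The
product `T(x) Θ(x;q)` occurring in `R` is first expanded into theta functions of `x^{2t}`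
(`bigTheta_mul_bigTheta`).

The difference `H` of the two solutions is holomorphic on the punctured plane with `H(qx) = -H(x)`.
By Liouville it is constant, hence zero (`eq_of_norm_eq_mul_left`, `bigTheta_mul_fTM`). -/

/-! ### Triangular exponents and convergence of Gaussian series -/

theorem two_mul_tri (r : ℤ) : 2 * (r * (r - 1) / 2) = r * (r - 1) :=
  Int.mul_ediv_cancel' (by
    obtain ⟨d, hd⟩ := Int.even_mul_pred_self r
    exact ⟨d, by linarith⟩)

theorem tri_succ (r : ℤ) : (r + 1) * (r + 1 - 1) / 2 = r * (r - 1) / 2 + r := by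
  have h1 := two_mul_tri r
  have h2 := two_mul_tri (r + 1)
  apply mul_left_cancel₀ (two_ne_zero' ℤ)
  linear_combination h2 - h1

theorem tri_pred (r : ℤ) : (r - 1) * (r - 1 - 1) / 2 = r * (r - 1) / 2 - r + 1 := by
  have h1 := two_mul_tri r
  have h2 := two_mul_tri (r - 1)
  apply mul_left_cancel₀ (two_ne_zero' ℤ)
  linear_combination h2 - h1

theorem tri_neg (r : ℤ) : (-r) * (-r - 1) / 2 = r * (r - 1) / 2 + r := by
  have h1 := two_mul_tri r
  have h2 := two_mul_tri (-r)
  apply mul_left_cancel₀ (two_ne_zero' ℤ)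
  linear_combination h2 - h1

theorem summable_nat_gauss {ρ z : ℝ} (hρ0 : 0 < ρ) (hρ1 : ρ < 1) (hz : 0 < z) :
    Summable fun n : ℕ => ρ ^ ((n : ℤ) * (n - 1) / 2) * z ^ (n : ℤ) := by
  have hlim : Tendsto (fun n : ℕ => ρ ^ n * z) atTop (𝓝 0) := by
    simpa using (tendsto_pow_atTop_nhds_zero_of_lt_one hρ0.le hρ1).mul_const z
  refine summable_of_ratio_test_tendsto_lt_one zero_lt_one
    (Eventually.of_forall fun n => by positivity) (hlim.congr fun n => ?_)
  have h1 : 0 < ρ ^ ((n : ℤ) * (n - 1) / 2) * z ^ (n : ℤ) := by positivity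
  rw [Real.norm_of_nonneg h1.le, Real.norm_of_nonneg (by positivity), eq_div_iff h1.ne']
  push_cast
  rw [tri_succ, zpow_add₀ hρ0.ne', zpow_add₀ hz.ne', zpow_natCast ρ, zpow_one]
  ring

theorem summable_gauss {ρ z : ℝ} (hρ0 : 0 < ρ) (hρ1 : ρ < 1) (hz : 0 < z) :
    Summable fun n : ℤ => ρ ^ (n * (n - 1) / 2) * z ^ n := by
  refine Summable.of_nat_of_neg (summable_nat_gauss hρ0 hρ1 hz) ?_
  refine (summable_nat_gauss hρ0 hρ1 (z := ρ * z⁻¹) (by positivity)).congr fun n => ?_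
  rw [tri_neg, zpow_add₀ hρ0.ne', mul_zpow, zpow_neg, inv_zpow]
  ring

/-- The general term of the theta series. -/
def thetaSeriesTerm (x q : ℂ) (r : ℤ) : ℂ := (-1) ^ r * q ^ (r * (r - 1) / 2) * x ^ r

theorem norm_neg_one_zpow (r : ℤ) : ‖(-1 : ℂ) ^ r‖ = 1 := by
  simp [norm_zpow]

theorem summable_norm_thetaSeriesTerm {x q : ℂ} (hq0 : q ≠ 0) (hq1 : ‖q‖ < 1) (hx : x ≠ 0) :
    Summable fun r => ‖thetaSeriesTerm x q r‖ := by
  refine (summable_gauss (norm_pos_iff.2 hq0) hq1 (norm_pos_iff.2 hx)).congr fun r => ?_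
  simp [thetaSeriesTerm]

/-! ### Pochhammer symbols and the Jacobi triple product -/

theorem qPochInf_ne_zero {x q : ℂ} (hq1 : ‖q‖ < 1) (h : ∀ i : ℕ, 1 - x * q ^ i ≠ 0) :
    qPochInf x q ≠ 0 := by
  have := tprod_one_add_ne_zero_of_summable (f := fun i : ℕ => -(x * q ^ i))
    (fun i => by simpa [sub_eq_add_neg] using h i)
    (by
      simp only [norm_neg, norm_mul, norm_pow]
      exact (summable_geometric_of_lt_one (norm_nonneg q) hq1).mul_left _)
  simpa [qPochInf, sub_eq_add_neg] using this

theorem one_sub_pow_succ_ne_zero {q : ℂ} (hq1 : ‖q‖ < 1) (n : ℕ) : 1 - q ^ (n + 1) ≠ 0 := by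
  intro h
  have h1 : ‖q ^ (n + 1)‖ = 1 := by rw [← sub_eq_zero.1 h]; simp
  rw [norm_pow] at h1
  exact absurd h1 (pow_lt_one₀ (norm_nonneg q) hq1 n.succ_ne_zero).ne

theorem qPochInf_self_ne_zero {q : ℂ} (hq1 : ‖q‖ < 1) : qPochInf q q ≠ 0 :=
  qPochInf_ne_zero hq1 fun i => by
    rw [← pow_succ']
    exact one_sub_pow_succ_ne_zero hq1 i

theorem qPochInf_eq_mul {x q : ℂ} (hq1 : ‖q‖ < 1) :
    qPochInf x q = (1 - x) * qPochInf (q * x) q := by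
  unfold qPochInf
  rw [tprod_eq_zero_mul']
  · simp only [pow_zero, mul_one, pow_succ']
    congr 1
    refine tprod_congr fun i => by ring
  · simpa [pow_succ', mul_assoc, mul_comm, mul_left_comm] using multipliable_qPochInf (q * x) hq1

/-- The finite `q`-Pochhammer symbol `(x; q)_n`. -/
def qPoch (x q : ℂ) (n : ℕ) : ℂ := ∏ i ∈ Finset.range n, (1 - x * q ^ i)

theorem tendsto_qPoch (x : ℂ) {q : ℂ} (hq1 : ‖q‖ < 1) :
    Tendsto (qPoch x q) atTop (𝓝 (qPochInf x q)) :=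
  (multipliable_qPochInf x hq1).hasProd.tendsto_prod_nat

/-- `1 / (q; q)_a`, extended by zero to negative `a`. -/
def invQPoch (q : ℂ) (a : ℤ) : ℂ := if 0 ≤ a then (qPoch q q a.toNat)⁻¹ else 0

theorem qPoch_self_ne_zero {q : ℂ} (hq1 : ‖q‖ < 1) (n : ℕ) : qPoch q q n ≠ 0 :=
  Finset.prod_ne_zero_iff.2 fun i _ => by
    rw [← pow_succ']
    exact one_sub_pow_succ_ne_zero hq1 i

theorem invQPoch_natCast (q : ℂ) (n : ℕ) : invQPoch q n = (qPoch q q n)⁻¹ := by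
  simp [invQPoch]

theorem invQPoch_of_neg (q : ℂ) {a : ℤ} (h : a < 0) : invQPoch q a = 0 := by
  simp [invQPoch, not_le.2 h]

/-- The extension by zero is consistent with the recursion because the factor `1 - q^a` vanishes at
`a = 0`. The induction for the finite triple product therefore needs no boundary cases. -/
theorem invQPoch_sub_one {q : ℂ} (hq1 : ‖q‖ < 1) (a : ℤ) :
    invQPoch q (a - 1) = (1 - q ^ a) * invQPoch q a := by
  rcases lt_trichotomy a 0 with h | rfl | h
  · rw [invQPoch_of_neg q h, invQPoch_of_neg q (by omega), mul_zero]
  · rw [invQPoch_of_neg q (by omega)]; simp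
  · obtain ⟨n, rfl⟩ : ∃ n : ℕ, a = n + 1 := ⟨(a - 1).toNat, by omega⟩
    have h1 := qPoch_self_ne_zero hq1 n
    have h2 := one_sub_pow_succ_ne_zero hq1 n
    rw [add_sub_cancel_right, invQPoch_natCast, show (n : ℤ) + 1 = ((n + 1 : ℕ) : ℤ) by simp,
      invQPoch_natCast, zpow_natCast, qPoch, qPoch, Finset.prod_range_succ, mul_inv, ← pow_succ',
      mul_left_comm, mul_inv_cancel₀ h2, mul_one]

theorem tendsto_invQPoch {q : ℂ} (hq1 : ‖q‖ < 1) :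
    Tendsto (invQPoch q) atTop (𝓝 (qPochInf q q)⁻¹) := by
  have h : Tendsto (fun a : ℤ => (qPoch q q a.toNat)⁻¹) atTop (𝓝 (qPochInf q q)⁻¹) := by
    refine Tendsto.inv₀ ((tendsto_qPoch q hq1).comp ?_) (qPochInf_self_ne_zero hq1)
    exact tendsto_atTop.2 fun n => (eventually_ge_atTop (n : ℤ)).mono fun a ha => by omega
  exact h.congr' ((eventually_ge_atTop 0).mono fun a ha => by simp [invQPoch, ha])

theorem exists_norm_invQPoch_le {q : ℂ} (hq1 : ‖q‖ < 1) : ∃ C, ∀ a, ‖invQPoch q a‖ ≤ C := by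
  have h : Tendsto (fun n : ℕ => invQPoch q n) atTop (𝓝 (qPochInf q q)⁻¹) :=
    (tendsto_invQPoch hq1).comp tendsto_natCast_atTop_atTop
  obtain ⟨C, hC⟩ := h.norm.bddAbove_range
  refine ⟨C, fun a => ?_⟩
  rcases lt_or_ge a 0 with ha | ha
  · rw [invQPoch_of_neg q ha, norm_zero]
    exact (norm_nonneg _).trans (hC ⟨0, rfl⟩)
  · lift a to ℕ using ha
    exact hC ⟨a, rfl⟩

/-- The finite form of the Jacobi triple product. -/
theorem hasSum_finite_triple_product {x q : ℂ} (hq0 : q ≠ 0) (hq1 : ‖q‖ < 1) (hx : x ≠ 0)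
    (n : ℕ) :
    HasSum (fun k : ℤ => thetaSeriesTerm x q k *
        (qPoch q q (2 * n) * (invQPoch q (n + k) * invQPoch q (n - k))))
      (qPoch x q n * qPoch (q / x) q n) := by
  induction n with
  | zero =>
    convert hasSum_single (0 : ℤ) ?_ using 1
    · simp [qPoch, thetaSeriesTerm, invQPoch]
    · intro k hk
      rcases lt_or_gt_of_ne hk with h | h
      · rw [invQPoch_of_neg q (a := ((0 : ℕ) : ℤ) + k) (by push_cast; omega)]; ring
      · rw [invQPoch_of_neg q (a := ((0 : ℕ) : ℤ) - k) (by push_cast; omega)]; ring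
  | succ n ih =>
    -- The new factors multiply to `(1 - x q^n)(1 - q^{n+1}/x) = 1 + q^{2n+1} - x q^n - q^{n+1}/x`,
    -- so the new series is a combination of the old one and its two shifts.
    have h1 := ih.mul_left (1 + q ^ (2 * n + 1))
    have h2 := ((Equiv.subRight (1 : ℤ)).hasSum_iff.2 ih).mul_left (-(x * q ^ n))
    have h3 := ((Equiv.addRight (1 : ℤ)).hasSum_iff.2 ih).mul_left (-(q ^ (n + 1) / x))
    have hv : qPoch x q (n + 1) * qPoch (q / x) q (n + 1) =
        (1 + q ^ (2 * n + 1)) * (qPoch x q n * qPoch (q / x) q n) +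
          -(x * q ^ n) * (qPoch x q n * qPoch (q / x) q n) +
          -(q ^ (n + 1) / x) * (qPoch x q n * qPoch (q / x) q n) := by
      simp only [qPoch, Finset.prod_range_succ]
      field_simp
      ring
    rw [hv]
    refine Eq.mpr (congrArg (fun f => HasSum f _) (funext fun k => ?_)) ((h1.add h2).add h3)
    · simp only [Function.comp_apply, Equiv.subRight_apply, Equiv.coe_addRight, thetaSeriesTerm,
        tri_succ, tri_pred]
      have e1 : invQPoch q (n + k) = (1 - q ^ ((n : ℤ) + 1 + k)) * invQPoch q (n + 1 + k) := by
        rw [← invQPoch_sub_one hq1]; congr 1; ring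
      have e2 : invQPoch q (n - k) = (1 - q ^ ((n : ℤ) + 1 - k)) * invQPoch q (n + 1 - k) := by
        rw [← invQPoch_sub_one hq1]; congr 1; ring
      have e3 : invQPoch q (n + (k - 1)) = (1 - q ^ ((n : ℤ) + k)) * invQPoch q (n + k) := by
        rw [← invQPoch_sub_one hq1]; congr 1; ring
      have e4 : invQPoch q (n - (k + 1)) = (1 - q ^ ((n : ℤ) - k)) * invQPoch q (n - k) := by
        rw [← invQPoch_sub_one hq1]; congr 1; ring
      have e5 : (n : ℤ) - (k - 1) = n + 1 - k := by ring
      have e6 : (n : ℤ) + (k + 1) = n + 1 + k := by ring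
      have e7 : ((n + 1 : ℕ) : ℤ) = (n : ℤ) + 1 := by simp
      have e8 : qPoch q q (2 * (n + 1)) =
          qPoch q q (2 * n) * (1 - q ^ (2 * n + 1)) * (1 - q ^ (2 * n + 2)) := by
        rw [show 2 * (n + 1) = 2 * n + 1 + 1 by ring, qPoch, qPoch, Finset.prod_range_succ,
          Finset.prod_range_succ]
        ring
      rw [e3, e4, e5, e6, e7, e1, e2, e8]
      have hm : (-1 : ℂ) ^ (k - 1) = -(-1) ^ k := by
        rw [zpow_sub₀ (by norm_num)]; simp [div_neg]
      have hp : (-1 : ℂ) ^ (k + 1) = -(-1) ^ k := by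
        rw [zpow_add₀ (by norm_num)]; simp
      rw [hm, hp]
      simp only [zpow_add₀ hq0, zpow_sub₀ hq0, zpow_add₀ hx, zpow_sub₀ hx, zpow_natCast, zpow_one,
        pow_add, pow_mul]
      have hk := zpow_ne_zero k hq0
      field_simp
      ring

/-- Let `n → ∞` in the finite triple product: each weight tends to `1/(q)_∞`, and the uniform bounds
on the Pochhammer factors allow dominated convergence. -/
theorem bigTheta_eq_tsum {x q : ℂ} (hq0 : q ≠ 0) (hq1 : ‖q‖ < 1) (hx : x ≠ 0) :
    bigTheta x q = ∑' r, thetaSeriesTerm x q r := by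
  obtain ⟨C, hC⟩ := exists_norm_invQPoch_le hq1
  have hC0 : 0 ≤ C := (norm_nonneg _).trans (hC 0)
  obtain ⟨D, hD⟩ := (tendsto_qPoch q hq1).norm.bddAbove_range
  have hD' : ∀ n, ‖qPoch q q n‖ ≤ D := fun n => hD ⟨n, rfl⟩
  have hD0 : 0 ≤ D := (norm_nonneg _).trans (hD' 0)
  have h0 := qPochInf_self_ne_zero hq1
  have hlim := tendsto_tsum_of_dominated_convergence
    (f := fun (n : ℕ) (k : ℤ) => thetaSeriesTerm x q k *
        (qPoch q q (2 * n) * (invQPoch q (n + k) * invQPoch q (n - k))))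
    (g := fun k => thetaSeriesTerm x q k * (qPochInf q q)⁻¹) (𝓕 := atTop)
    (bound := fun k => ‖thetaSeriesTerm x q k‖ * (D * (C * C)))
    ((summable_norm_thetaSeriesTerm hq0 hq1 hx).mul_right _)
    (fun k => by
      have h1 : Tendsto (fun n : ℕ => qPoch q q (2 * n)) atTop (𝓝 (qPochInf q q)) :=
        (tendsto_qPoch q hq1).comp (tendsto_id.const_mul_atTop' two_pos)
      have h2 : Tendsto (fun n : ℕ => invQPoch q (n + k)) atTop (𝓝 (qPochInf q q)⁻¹) :=
        (tendsto_invQPoch hq1).comp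
          (tendsto_atTop_add_const_right _ k tendsto_natCast_atTop_atTop)
      have h3 : Tendsto (fun n : ℕ => invQPoch q (n - k)) atTop (𝓝 (qPochInf q q)⁻¹) := by
        exact (tendsto_invQPoch hq1).comp
          (tendsto_atTop_add_const_right _ (-k) tendsto_natCast_atTop_atTop)
      have := (h1.mul (h2.mul h3)).const_mul (thetaSeriesTerm x q k)
      rwa [← mul_assoc (qPochInf q q), mul_inv_cancel₀ h0, one_mul] at this)
    (Eventually.of_forall fun n k => by
      simp only [norm_mul]
      gcongr <;> first | apply hD' | apply hC)
  simp only [(hasSum_finite_triple_product hq0 hq1 hx _).tsum_eq] at hlim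
  have := tendsto_nhds_unique hlim ((tendsto_qPoch x hq1).mul (tendsto_qPoch (q / x) hq1))
  rw [bigTheta, ← this, tsum_mul_right, mul_assoc, inv_mul_cancel₀ h0, mul_one]

theorem hasSum_thetaSeriesTerm {x q : ℂ} (hq0 : q ≠ 0) (hq1 : ‖q‖ < 1) (hx : x ≠ 0) :
    HasSum (thetaSeriesTerm x q) (bigTheta x q) :=
  bigTheta_eq_tsum hq0 hq1 hx ▸ (summable_norm_thetaSeriesTerm hq0 hq1 hx).of_norm.hasSum

/-! ### Holomorphy and quasi-periodicity of `Θ`, and its quotients by single factors -/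

theorem differentiable_qPochInf {q : ℂ} (hq1 : ‖q‖ < 1) :
    Differentiable ℂ fun x => qPochInf x q := by
  intro x
  have hK : IsOpen (Metric.ball (0 : ℂ) (‖x‖ + 1)) := Metric.isOpen_ball
  have h := Summable.hasProdLocallyUniformlyOn_nat_one_add (f := fun i x => -(x * q ^ i)) hK
    ((summable_geometric_of_lt_one (norm_nonneg q) hq1).mul_left (‖x‖ + 1))
    (Eventually.of_forall fun n y hy => by
      rw [norm_neg, norm_mul, norm_pow]
      gcongr
      simpa using (mem_ball_zero_iff.1 hy).le)
    (fun n => by fun_prop)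
  have h2 := TendstoLocallyUniformlyOn.differentiableOn h
    (Eventually.of_forall fun s => by
      refine DifferentiableOn.fun_finsetProd fun i _ => ?_
      fun_prop) hK
  have h3 := h2.differentiableAt (hK.mem_nhds (by simp : x ∈ Metric.ball (0 : ℂ) (‖x‖ + 1)))
  simpa [qPochInf, sub_eq_add_neg] using h3

/-- The quotient `Θ(x; q) / (1 - x)`, as a product. -/
def thetaQuot (q x : ℂ) : ℂ := qPochInf (q * x) q * qPochInf (q / x) q * qPochInf q q

theorem bigTheta_eq_mul_thetaQuot (x : ℂ) {q : ℂ} (hq1 : ‖q‖ < 1) :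
    bigTheta x q = (1 - x) * thetaQuot q x := by
  rw [bigTheta, thetaQuot, qPochInf_eq_mul hq1]; ring

theorem thetaQuot_one (q : ℂ) : thetaQuot q 1 = qPochInf q q ^ 3 := by
  simp [thetaQuot]; ring

theorem differentiableOn_thetaQuot {q : ℂ} (hq1 : ‖q‖ < 1) :
    DifferentiableOn ℂ (thetaQuot q) {0}ᶜ := by
  have h := differentiable_qPochInf hq1
  refine DifferentiableOn.mul (DifferentiableOn.mul ?_ ?_) (differentiableOn_const _)
  · exact (h.comp (differentiable_id.const_mul q)).differentiableOn
  · exact h.comp_differentiableOn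
      ((differentiableOn_const q).div differentiableOn_id fun x hx => hx)

theorem differentiableOn_bigTheta {q : ℂ} (hq1 : ‖q‖ < 1) :
    DifferentiableOn ℂ (fun x => bigTheta x q) {0}ᶜ := by
  simp only [fun x => bigTheta_eq_mul_thetaQuot x hq1]
  exact DifferentiableOn.mul (by fun_prop) (differentiableOn_thetaQuot hq1)

theorem tri_add (k n : ℤ) :
    (k + n) * (k + n - 1) / 2 = k * (k - 1) / 2 + n * (n - 1) / 2 + n * k := by
  apply mul_left_cancel₀ (two_ne_zero' ℤ)
  linear_combination two_mul_tri (k + n) - two_mul_tri k - two_mul_tri n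

/-- Shifting the summation index of the theta series by `n` gives the multiplier. -/
theorem bigTheta_zpow_mul {x q : ℂ} (hq0 : q ≠ 0) (hq1 : ‖q‖ < 1) (hx : x ≠ 0) (n : ℤ) :
    bigTheta x q = (-1) ^ n * q ^ (n * (n - 1) / 2) * x ^ n * bigTheta (q ^ n * x) q := by
  have h1 := (Equiv.addRight n).hasSum_iff.2 (hasSum_thetaSeriesTerm hq0 hq1 hx)
  have h2 := (hasSum_thetaSeriesTerm hq0 hq1
    (mul_ne_zero (zpow_ne_zero n hq0) hx)).mul_left ((-1) ^ n * q ^ (n * (n - 1) / 2) * x ^ n)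
  refine h1.unique (h2.congr_fun ?_)
  intro k
  simp only [Function.comp_apply, Equiv.coe_addRight, thetaSeriesTerm, tri_add,
    zpow_add₀ hq0, zpow_add₀ hx, zpow_add₀ (neg_ne_zero.2 (one_ne_zero' ℂ)), mul_zpow, zpow_mul]
  ring

/-- The quotient `Θ(x; q) / (1 - x q ^ n)`, continued to its removable singularity. -/
def thetaOver (q : ℂ) (n : ℤ) (x : ℂ) : ℂ :=
  (-1) ^ n * q ^ (n * (n - 1) / 2) * x ^ n * thetaQuot q (q ^ n * x)

/-- Quasi-periodicity carries the zero `q^{-n}` of `Θ` to `1`, where the factor `1 - x` is explicit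
in the product. -/
theorem one_sub_mul_thetaOver {x q : ℂ} (hq0 : q ≠ 0) (hq1 : ‖q‖ < 1) (hx : x ≠ 0) (n : ℤ) :
    (1 - x * q ^ n) * thetaOver q n x = bigTheta x q := by
  rw [bigTheta_zpow_mul hq0 hq1 hx n, bigTheta_eq_mul_thetaQuot _ hq1, thetaOver]; ring

theorem bigTheta_zpow {q : ℂ} (hq0 : q ≠ 0) (hq1 : ‖q‖ < 1) (l : ℤ) : bigTheta (q ^ l) q = 0 := by
  have := one_sub_mul_thetaOver hq0 hq1 (zpow_ne_zero l hq0) (-l)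
  rw [← this, ← zpow_add₀ hq0]; simp

theorem bigTheta_mul_left {x q : ℂ} (hq0 : q ≠ 0) (hq1 : ‖q‖ < 1) (hx : x ≠ 0) :
    bigTheta (q * x) q = -x⁻¹ * bigTheta x q := by
  rw [bigTheta_zpow_mul hq0 hq1 hx 1]; simp; field_simp

theorem thetaOver_mul_left {x q : ℂ} (hq0 : q ≠ 0) (hx : x ≠ 0) (n : ℤ) :
    thetaOver q n (q * x) = -x⁻¹ * thetaOver q (n + 1) x := by
  simp only [thetaOver, tri_succ, zpow_add₀ hq0, zpow_add₀ hx,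
    zpow_add₀ (neg_ne_zero.2 (one_ne_zero' ℂ)), mul_zpow, zpow_one, mul_assoc]
  field_simp

theorem differentiableOn_thetaOver {q : ℂ} (hq0 : q ≠ 0) (hq1 : ‖q‖ < 1) (n : ℤ) :
    DifferentiableOn ℂ (thetaOver q n) {0}ᶜ := by
  unfold thetaOver
  refine DifferentiableOn.mul (DifferentiableOn.mul (differentiableOn_const _) ?_) ?_
  · exact differentiableOn_id.zpow (Or.inl fun x hx => hx)
  · exact (differentiableOn_thetaQuot hq1).comp (by fun_prop)
      fun x hx => mul_ne_zero (zpow_ne_zero n hq0) hx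

/-! ### Uniform estimates on annuli -/

/-- On an annulus `x q^n` tends uniformly to `0` as `n → ∞` and to infinity as `n → -∞`, so only
finitely many `n` can bring it near `1`. -/
theorem exists_half_le_norm_one_sub {q : ℂ} (hq0 : q ≠ 0) (hq1 : ‖q‖ < 1) {a : ℝ} (b : ℝ)
    (ha : 0 < a) :
    ∃ N : ℕ, ∀ n : ℤ, n ∉ Finset.Icc (-N : ℤ) N → ∀ x : ℂ, a ≤ ‖x‖ → ‖x‖ ≤ b →
      1 / 2 ≤ ‖1 - x * q ^ n‖ := by
  have hq := norm_pos_iff.2 hq0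
  have ht := tendsto_pow_atTop_nhds_zero_of_lt_one (norm_nonneg q) hq1
  have h1 : ∀ᶠ N : ℕ in atTop, b * ‖q‖ ^ N < 1 / 2 :=
    (ht.const_mul b).eventually_lt_const (by norm_num)
  have h2 : ∀ᶠ N : ℕ in atTop, 2 * ‖q‖ ^ N < a :=
    (ht.const_mul 2).eventually_lt_const (by simpa using ha)
  obtain ⟨N, hN1, hN2⟩ := (h1.and h2).exists
  refine ⟨N, fun n hn x hxa hxb => ?_⟩
  rcases le_or_gt 0 n with h0 | h0
  · have hle : ‖x * q ^ n‖ ≤ 1 / 2 := by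
      have hb : 0 ≤ b := (norm_nonneg x).trans hxb
      lift n to ℕ using h0
      have hNn : N ≤ n := by
        by_contra hlt
        exact hn (Finset.mem_Icc.2 ⟨by omega, by omega⟩)
      rw [zpow_natCast, norm_mul, norm_pow]
      calc ‖x‖ * ‖q‖ ^ n ≤ b * ‖q‖ ^ N := by
            gcongr ?_ * ?_
            exact pow_le_pow_of_le_one hq.le hq1.le hNn
        _ ≤ 1 / 2 := hN1.le
    have := norm_sub_norm_le 1 (x * q ^ n)
    rw [norm_one] at this
    linarith
  · obtain ⟨k, rfl⟩ : ∃ k : ℕ, n = -k := ⟨(-n).toNat, by omega⟩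
    have hNk : N ≤ k := by
      by_contra hlt
      exact hn (Finset.mem_Icc.2 ⟨by omega, by omega⟩)
    have hle : 2 ≤ ‖x * q ^ (-(k : ℤ))‖ := by
      rw [zpow_neg, zpow_natCast, norm_mul, norm_inv, norm_pow, ← div_eq_mul_inv,
        le_div_iff₀ (by positivity)]
      have := pow_le_pow_of_le_one hq.le hq1.le hNk
      linarith
    have := norm_sub_norm_le (x * q ^ (-(k : ℤ))) 1
    rw [norm_one, norm_sub_rev] at this
    linarith

theorem exists_le_norm_one_sub {x q : ℂ} (hq0 : q ≠ 0) (hq1 : ‖q‖ < 1) (hx : x ≠ 0)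
    (h : ∀ n : ℤ, 1 - x * q ^ n ≠ 0) : ∃ δ > 0, ∀ n : ℤ, δ ≤ ‖1 - x * q ^ n‖ := by
  obtain ⟨N, hN⟩ := exists_half_le_norm_one_sub hq0 hq1 ‖x‖ (norm_pos_iff.2 hx)
  have hne : (Finset.Icc (-N : ℤ) N).Nonempty := ⟨0, by simp⟩
  obtain ⟨k, -, hk⟩ := Finset.exists_min_image _ (fun n : ℤ => ‖1 - x * q ^ n‖) hne
  refine ⟨min (1 / 2) ‖1 - x * q ^ k‖, lt_min (by norm_num) (norm_pos_iff.2 (h k)), fun n => ?_⟩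
  by_cases hn : n ∈ Finset.Icc (-N : ℤ) N
  · exact (min_le_right _ _).trans (hk n hn)
  · exact (min_le_left _ _).trans (hN n hn x le_rfl le_rfl)

theorem isCompact_annulus (a b : ℝ) : IsCompact {x : ℂ | a ≤ ‖x‖ ∧ ‖x‖ ≤ b} := by
  refine (isCompact_closedBall (0 : ℂ) b).of_isClosed_subset ?_ fun x hx => by simpa using hx.2
  exact (isClosed_le continuous_const continuous_norm).inter
    (isClosed_le continuous_norm continuous_const)

theorem exists_norm_le_annulus {f : ℂ → ℂ} (hf : ContinuousOn f {0}ᶜ) {a : ℝ} (b : ℝ)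
    (ha : 0 < a) : ∃ C, 0 ≤ C ∧ ∀ x, a ≤ ‖x‖ → ‖x‖ ≤ b → ‖f x‖ ≤ C := by
  obtain ⟨C, hC⟩ := (isCompact_annulus a b).exists_bound_of_continuousOn
    (hf.mono fun x hx => norm_pos_iff.1 (ha.trans_le hx.1))
  exact ⟨max C 0, le_max_right _ _, fun x h1 h2 => (hC x ⟨h1, h2⟩).trans (le_max_left _ _)⟩

/-- The bound is uniform in `n` and includes the removable singularities. Compactness handles the
finitely many dangerous `n`; for the others the denominator is at least `1/2`. -/
theorem exists_norm_thetaOver_le {q : ℂ} (hq0 : q ≠ 0) (hq1 : ‖q‖ < 1) {a : ℝ} (b : ℝ)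
    (ha : 0 < a) : ∃ C, 0 ≤ C ∧ ∀ n x, a ≤ ‖x‖ → ‖x‖ ≤ b → ‖thetaOver q n x‖ ≤ C := by
  obtain ⟨N, hN⟩ := exists_half_le_norm_one_sub hq0 hq1 b ha
  obtain ⟨M, hM0, hM⟩ := exists_norm_le_annulus (differentiableOn_bigTheta hq1).continuousOn b ha
  choose c hc0 hc using fun n : ℤ =>
    exists_norm_le_annulus (differentiableOn_thetaOver hq0 hq1 n).continuousOn b ha
  have hs : 0 ≤ ∑ n ∈ Finset.Icc (-N : ℤ) N, c n := Finset.sum_nonneg fun n _ => hc0 n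
  refine ⟨2 * M + ∑ n ∈ Finset.Icc (-N : ℤ) N, c n, by linarith, fun n x h1 h2 => ?_⟩
  by_cases hn : n ∈ Finset.Icc (-N : ℤ) N
  · have := Finset.single_le_sum (fun i _ => hc0 i) hn
    linarith [hc n x h1 h2]
  · have e := congrArg norm (one_sub_mul_thetaOver hq0 hq1 (norm_pos_iff.1 (ha.trans_le h1)) n)
    rw [norm_mul] at e
    have := hN n hn x h1 h2
    nlinarith [hM x h1 h2, norm_nonneg (thetaOver q n x)]

theorem isOpen_annulus (a b : ℝ) : IsOpen {x : ℂ | a < ‖x‖ ∧ ‖x‖ < b} :=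
  (isOpen_lt continuous_const continuous_norm).inter
    (isOpen_lt continuous_norm continuous_const)

theorem differentiableOn_of_annulus {f : ℂ → ℂ}
    (h : ∀ a b : ℝ, 0 < a → DifferentiableOn ℂ f {x | a < ‖x‖ ∧ ‖x‖ < b}) :
    DifferentiableOn ℂ f {0}ᶜ := by
  intro x hx
  have hx' : 0 < ‖x‖ := norm_pos_iff.2 hx
  refine ((h (‖x‖ / 2) (2 * ‖x‖) (by positivity)).differentiableAt ?_).differentiableWithinAt
  exact (isOpen_annulus _ _).mem_nhds ⟨by linarith, by linarith⟩

/-! ### Sums with simple poles, multiplied by `Θ` -/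

/-- The product of `Θ(x; q)` and `∑ a n / (1 - x q ^ n)`. -/
def thetaAppell (q : ℂ) (a : ℤ → ℂ) (x : ℂ) : ℂ := ∑' n, a n * thetaOver q n x

theorem summable_thetaAppell {x q : ℂ} (hq0 : q ≠ 0) (hq1 : ‖q‖ < 1) (hx : x ≠ 0) {a : ℤ → ℂ}
    (ha : Summable a) : Summable fun n => a n * thetaOver q n x := by
  obtain ⟨C, -, hC⟩ := exists_norm_thetaOver_le hq0 hq1 ‖x‖ (norm_pos_iff.2 hx)
  refine Summable.of_norm_bounded (ha.norm.mul_right C) fun n => ?_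
  rw [norm_mul]
  gcongr
  exact hC n x le_rfl le_rfl

theorem differentiableOn_thetaAppell {q : ℂ} (hq0 : q ≠ 0) (hq1 : ‖q‖ < 1) {a : ℤ → ℂ}
    (ha : Summable a) : DifferentiableOn ℂ (thetaAppell q a) {0}ᶜ := by
  refine differentiableOn_of_annulus fun r s hr => ?_
  obtain ⟨C, -, hC⟩ := exists_norm_thetaOver_le hq0 hq1 s hr
  refine Complex.differentiableOn_tsum_of_summable_norm (ha.norm.mul_right C) (fun n => ?_)
    (isOpen_annulus r s) fun n x hx => ?_
  · exact ((differentiableOn_thetaOver hq0 hq1 n).const_mul _).mono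
      fun x hx => norm_pos_iff.1 (hr.trans hx.1)
  · rw [norm_mul]
    gcongr
    exact hC n x hx.1.le hx.2.le

theorem thetaAppell_mul_left {x q : ℂ} (hq0 : q ≠ 0) (hx : x ≠ 0) (a : ℤ → ℂ) :
    thetaAppell q a (q * x) = -x⁻¹ * thetaAppell q (fun n => a (n - 1)) x := by
  unfold thetaAppell
  rw [← (Equiv.addRight (1 : ℤ)).tsum_eq (fun n => a (n - 1) * thetaOver q n x), ← tsum_mul_left]
  refine tsum_congr fun n => ?_
  simp [thetaOver_mul_left hq0 hx]
  ring

/-- This is `1/(1 - x q^n) = x q^n/(1 - x q^n) + 1`, summed against the coefficients and multiplied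
by `Θ`. -/
theorem thetaAppell_eq_add {x q : ℂ} (hq0 : q ≠ 0) (hq1 : ‖q‖ < 1) (hx : x ≠ 0) {a : ℤ → ℂ}
    (ha : Summable a) (ha' : Summable fun n => a n * q ^ n) :
    thetaAppell q a x =
      x * thetaAppell q (fun n => a n * q ^ n) x + bigTheta x q * ∑' n, a n := by
  unfold thetaAppell
  rw [← tsum_mul_left, ← tsum_mul_left, ← Summable.tsum_add
    ((summable_thetaAppell hq0 hq1 hx ha').mul_left x) (ha.mul_left _)]
  refine tsum_congr fun n => ?_
  rw [← one_sub_mul_thetaOver hq0 hq1 hx n]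
  ring

/-! ### Liouville's theorem on the punctured plane modulo `q` -/

/-- The modulus is bounded by its maximum on `|q| ≤ |x| ≤ 1`, so `f ∘ exp` is a bounded entire
function. Assuming invariance of the modulus only covers both `f(qx) = f(x)` and `f(qx) = -f(x)`. -/
theorem eq_of_norm_eq_mul_left {q : ℂ} (hq0 : q ≠ 0) (hq1 : ‖q‖ < 1) {f : ℂ → ℂ}
    (hf : DifferentiableOn ℂ f {0}ᶜ) (h : ∀ x, x ≠ 0 → ‖f (q * x)‖ = ‖f x‖) {x y : ℂ}
    (hx : x ≠ 0) (hy : y ≠ 0) : f x = f y := by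
  have hq := norm_pos_iff.2 hq0
  obtain ⟨C, -, hC⟩ := exists_norm_le_annulus hf.continuousOn 1 hq
  have hz : ∀ (n : ℤ) (x : ℂ), x ≠ 0 → ‖f (q ^ n * x)‖ = ‖f x‖ := by
    intro n
    induction n with
    | zero => simp
    | succ n ih =>
      intro x hx
      rw [← ih x hx, ← h (q ^ (n : ℤ) * x) (mul_ne_zero (zpow_ne_zero _ hq0) hx), ← mul_assoc,
        ← zpow_one_add₀ hq0, add_comm (1 : ℤ)]
    | pred n ih =>
      intro x hx
      rw [← ih x hx, ← h (q ^ (-(n : ℤ) - 1) * x) (mul_ne_zero (zpow_ne_zero _ hq0) hx),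
        ← mul_assoc, ← zpow_one_add₀ hq0]
      congr 4
      ring
  have hb : ∀ x, x ≠ 0 → ‖f x‖ ≤ C := by
    intro x hx
    obtain ⟨n, hn1, hn2⟩ := exists_mem_Ioc_zpow (norm_pos_iff.2 hx) (one_lt_inv_iff₀.2 ⟨hq, hq1⟩)
    rw [← hz (n + 1) x hx]
    rw [inv_zpow, ← zpow_neg] at hn1 hn2
    refine hC _ ?_ ?_ <;> rw [norm_mul, norm_zpow]
    · calc ‖q‖ = ‖q‖ ^ (n + 1) * ‖q‖ ^ (-n) := by rw [← zpow_add₀ hq.ne']; simp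
        _ ≤ _ := by gcongr
    · calc ‖q‖ ^ (n + 1) * ‖x‖ ≤ ‖q‖ ^ (n + 1) * ‖q‖ ^ (-(n + 1)) := by gcongr
        _ = 1 := by rw [← zpow_add₀ hq.ne']; simp
  have hd : Differentiable ℂ fun z => f (Complex.exp z) := fun z =>
    (hf.differentiableAt (isOpen_compl_singleton.mem_nhds (Complex.exp_ne_zero z))).comp z
      Complex.differentiable_exp.differentiableAt
  have := hd.apply_eq_apply_of_bounded
    (isBounded_iff_forall_norm_le.2 ⟨C, by rintro _ ⟨z, rfl⟩; exact hb _ (Complex.exp_ne_zero z)⟩)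
    (Complex.log x) (Complex.log y)
  simpa [Complex.exp_log hx, Complex.exp_log hy] using this

/-! ### Level-one Appell sums in closed form -/

/-- The coefficients `(-1) ^ n q ^ (n (n - 1) / 2 + l n)` of the level one Appell sums. -/
def appellCoeff (q : ℂ) (l n : ℤ) : ℂ := thetaSeriesTerm (q ^ l) q n

theorem summable_appellCoeff {q : ℂ} (hq0 : q ≠ 0) (hq1 : ‖q‖ < 1) (l : ℤ) :
    Summable (appellCoeff q l) :=
  (summable_norm_thetaSeriesTerm hq0 hq1 (zpow_ne_zero l hq0)).of_norm

theorem tsum_appellCoeff {q : ℂ} (hq0 : q ≠ 0) (hq1 : ‖q‖ < 1) (l : ℤ) :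
    ∑' n, appellCoeff q l n = 0 := by
  rw [← bigTheta_zpow hq0 hq1 l]
  exact (hasSum_thetaSeriesTerm hq0 hq1 (zpow_ne_zero l hq0)).tsum_eq

theorem appellCoeff_mul_zpow {q : ℂ} (hq0 : q ≠ 0) (l k n : ℤ) :
    appellCoeff q l n * q ^ (k * n) = appellCoeff q (l + k) n := by
  simp only [appellCoeff, thetaSeriesTerm, zpow_add₀ hq0, mul_zpow, zpow_mul]
  ring

/-- The inhomogeneous term of `thetaAppell_eq_add` is a multiple of `Θ(q^l; q) = 0`. -/
theorem thetaAppell_appellCoeff_eq {x q : ℂ} (hq0 : q ≠ 0) (hq1 : ‖q‖ < 1) (hx : x ≠ 0) (l : ℤ) :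
    thetaAppell q (appellCoeff q l) x = x * thetaAppell q (appellCoeff q (l + 1)) x := by
  have h : (fun n => appellCoeff q l n * q ^ n) = appellCoeff q (l + 1) := by
    funext n; rw [← appellCoeff_mul_zpow hq0, one_mul]
  rw [thetaAppell_eq_add hq0 hq1 hx (summable_appellCoeff hq0 hq1 l)
    (h ▸ summable_appellCoeff hq0 hq1 (l + 1)), h, tsum_appellCoeff hq0 hq1, mul_zero, add_zero]

/-- The left side is invariant under `x ↦ qx`, hence constant. At `x = 1` every term with `n ≠ 0`
vanishes with `Θ(1; q)`, and the term `n = 0` is `(q)_∞^3`. -/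
theorem thetaAppell_appellCoeff_one {x q : ℂ} (hq0 : q ≠ 0) (hq1 : ‖q‖ < 1) (hx : x ≠ 0) :
    thetaAppell q (appellCoeff q 1) x = qPochInf q q ^ 3 := by
  have hinv : ∀ x, x ≠ 0 →
      thetaAppell q (appellCoeff q 1) (q * x) = thetaAppell q (appellCoeff q 1) x := by
    intro x hx
    have h : (fun n => appellCoeff q 1 (n - 1)) = fun n => -appellCoeff q 0 n := by
      funext n
      simp only [appellCoeff, thetaSeriesTerm, tri_pred, zpow_sub₀ hq0, zpow_add₀ hq0,
        zpow_sub₀ (neg_ne_zero.2 (one_ne_zero' ℂ)), zpow_one, zpow_zero, one_zpow]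
      have := zpow_ne_zero n hq0
      field_simp
    rw [thetaAppell_mul_left hq0 hx, h]
    have h2 : thetaAppell q (fun n => -appellCoeff q 0 n) x
        = -thetaAppell q (appellCoeff q 0) x := by
      simp [thetaAppell, neg_mul, tsum_neg]
    rw [h2, thetaAppell_appellCoeff_eq hq0 hq1 hx]
    field_simp
    simp
  rw [eq_of_norm_eq_mul_left hq0 hq1
    (differentiableOn_thetaAppell hq0 hq1 (summable_appellCoeff hq0 hq1 1))
    (fun x hx => by rw [hinv x hx]) hx one_ne_zero, thetaAppell, tsum_eq_single 0]
  · simp [appellCoeff, thetaSeriesTerm, thetaOver, thetaQuot_one]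
  · intro n hn
    have h1 := one_sub_mul_thetaOver hq0 hq1 one_ne_zero n
    have h2 : bigTheta 1 q = 0 := by simpa using bigTheta_zpow hq0 hq1 0
    rw [h2, one_mul, mul_eq_zero] at h1
    rcases h1 with h1 | h1
    · have h3 : ‖q‖ ^ n = 1 := by rw [← norm_zpow, ← sub_eq_zero.1 h1, norm_one]
      exact absurd ((zpow_eq_one_iff_right₀ (norm_nonneg q) hq1.ne).1 h3) hn
    · rw [h1, mul_zero]

theorem thetaAppell_appellCoeff {x q : ℂ} (hq0 : q ≠ 0) (hq1 : ‖q‖ < 1) (hx : x ≠ 0) (j : ℕ) :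
    thetaAppell q (appellCoeff q (1 - j)) x = x ^ j * qPochInf q q ^ 3 := by
  induction j with
  | zero => simpa using thetaAppell_appellCoeff_one hq0 hq1 hx
  | succ j ih =>
    rw [thetaAppell_appellCoeff_eq hq0 hq1 hx,
      show (1 : ℤ) - (j + 1 : ℕ) + 1 = 1 - j by push_cast; ring, ih]
    ring

/-! ### When the Appell function is defined -/

theorem bigTheta_ne_zero {z q : ℂ} (hq0 : q ≠ 0) (hq1 : ‖q‖ < 1) (hz : ∀ n : ℤ, z ≠ q ^ n) :
    bigTheta z q ≠ 0 := by
  refine mul_ne_zero (mul_ne_zero (qPochInf_ne_zero hq1 fun i h => ?_)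
    (qPochInf_ne_zero hq1 fun i h => ?_)) (qPochInf_self_ne_zero hq1)
  · refine hz (-i) ?_
    rw [zpow_neg, zpow_natCast]
    exact eq_inv_of_mul_eq_one_left (sub_eq_zero.1 h).symm
  · refine hz (i + 1) ?_
    rcases eq_or_ne z 0 with rfl | h0
    · simp at h
    · field_simp at h
      rw [zpow_add₀ hq0, zpow_one, zpow_natCast]
      linear_combination h

theorem one_add_zpow_ne_zero {q : ℂ} (hq1 : ‖q‖ < 1) (n : ℤ) : 1 + q ^ n ≠ 0 := by
  intro h
  have h1 : q ^ n = -1 := by linear_combination h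
  have h2 : ‖q‖ ^ n = 1 := by rw [← norm_zpow, h1, norm_neg, norm_one]
  have h3 := (zpow_eq_one_iff_right₀ (norm_nonneg q) hq1.ne).1 h2
  rw [h3, zpow_zero] at h1
  norm_num at h1

theorem summable_appellTerm {X Z q : ℂ} (hq0 : q ≠ 0) (hq1 : ‖q‖ < 1) (hX : X ≠ 0) (hZ : Z ≠ 0)
    (h : ∀ r : ℤ, 1 - q ^ (r - 1) * X * Z ≠ 0) : Summable (appellTerm X Z q) := by
  have e : ∀ r : ℤ, 1 - q ^ (r - 1) * X * Z = 1 - (q⁻¹ * X * Z) * q ^ r := fun r => by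
    rw [zpow_sub₀ hq0, zpow_one]; field_simp
  obtain ⟨δ, hδ, hδ'⟩ := exists_le_norm_one_sub hq0 hq1
    (mul_ne_zero (mul_ne_zero (inv_ne_zero hq0) hX) hZ) fun n => e n ▸ h n
  refine Summable.of_norm_bounded
    ((summable_norm_thetaSeriesTerm hq0 hq1 hZ).mul_right δ⁻¹) fun r => ?_
  rw [appellTerm, norm_div, e, div_eq_mul_inv]
  change ‖thetaSeriesTerm Z q r‖ * _ ≤ _
  gcongr
  exact hδ' r

/-- When `XZ = -q^a` the denominators are `1 + q^N`, which never vanish for `0 < |q| < 1`; only the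
zeros of `Θ(Z; q^n)` must be avoided. -/
theorem appellDefined_of_mul_eq {X Z q : ℂ} (hq0 : q ≠ 0) (hq1 : ‖q‖ < 1) {n : ℕ} (hn : n ≠ 0)
    (a : ℤ) (hX : X ≠ 0) (hZ : ∀ k : ℤ, Z ≠ (q ^ n) ^ k) (hZ0 : Z ≠ 0) (h : X * Z = -q ^ a) :
    AppellDefined X Z (q ^ n) := by
  have hQ0 : q ^ n ≠ 0 := pow_ne_zero n hq0
  have hQ1 : ‖q ^ n‖ < 1 := by
    rw [norm_pow]; exact pow_lt_one₀ (norm_nonneg q) hq1 hn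
  have hd : ∀ r : ℤ, 1 - (q ^ n) ^ (r - 1) * X * Z ≠ 0 := fun r => by
    rw [mul_assoc, h, mul_neg, sub_neg_eq_add, ← zpow_natCast, ← zpow_mul, ← zpow_add₀ hq0]
    exact one_add_zpow_ne_zero hq1 _
  exact ⟨bigTheta_ne_zero hQ0 hQ1 hZ, hd, summable_appellTerm hQ0 hQ1 hX hZ0 hd⟩

/-! ### Laurent series solving `L(qx) + L(x) = x^{a-n} Θ(u x^n; q^n)` -/

/-- The Laurent series obtained from `x ^ (a - n) * Θ(u x ^ n; q ^ n)` by dividing the coefficient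
of `x ^ N` by `1 + q ^ N`. -/
def appellLaurent (q u : ℂ) (n : ℕ) (a : ℤ) (x : ℂ) : ℂ :=
  ∑' r : ℤ, thetaSeriesTerm u (q ^ n) r / (1 + q ^ (n * (r - 1) + a)) * x ^ (n * (r - 1) + a)

section appellLaurent

variable {q u : ℂ} (hq0 : q ≠ 0) (hq1 : ‖q‖ < 1) (hu : u ≠ 0) {n : ℕ} (hn : n ≠ 0) (a : ℤ)

include hq0 hq1 hu hn

theorem summable_appellLaurent_aux {ρ : ℝ} (hρ : 0 < ρ) :
    Summable fun r : ℤ => ‖thetaSeriesTerm u (q ^ n) r / (1 + q ^ (n * (r - 1) + a))‖ *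
      ρ ^ (n * (r - 1) + a) := by
  have hQ1 : ‖q‖ ^ n < 1 := pow_lt_one₀ (norm_nonneg q) hq1 hn
  have hqp := norm_pos_iff.2 hq0
  have hup := norm_pos_iff.2 hu
  obtain ⟨δ, hδ, hδ'⟩ := exists_le_norm_one_sub hq0 hq1 (x := -1) (by norm_num)
    fun k => by simpa using one_add_zpow_ne_zero hq1 k
  refine Summable.of_nonneg_of_le (fun r => by positivity) (fun r => ?_)
    ((summable_gauss (pow_pos hqp n) hQ1 (z := ‖u‖ * ρ ^ n) (by positivity)).mul_right
      (ρ ^ (a - n) * δ⁻¹))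
  have h1 := hδ' (n * (r - 1) + a)
  rw [neg_mul, one_mul, sub_neg_eq_add] at h1
  have h2 : ρ ^ (n * (r - 1) + a) = (ρ ^ n) ^ r * ρ ^ (a - n) := by
    rw [← zpow_natCast ρ n, ← zpow_mul, ← zpow_add₀ hρ.ne']; congr 1; ring
  rw [h2, norm_div, thetaSeriesTerm, norm_mul, norm_mul, norm_neg_one_zpow, norm_zpow, norm_pow,
    norm_zpow, mul_zpow, div_eq_mul_inv, one_mul]
  have h3 : ‖1 + q ^ (n * (r - 1) + a)‖⁻¹ ≤ δ⁻¹ := by gcongr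
  calc _ = (‖q‖ ^ n) ^ (r * (r - 1) / 2) * (‖u‖ ^ r * (ρ ^ n) ^ r) * (ρ ^ (a - n) *
        ‖1 + q ^ (n * (r - 1) + a)‖⁻¹) := by ring
    _ ≤ _ := by gcongr

theorem summable_appellLaurent {x : ℂ} (hx : x ≠ 0) :
    Summable fun r : ℤ => thetaSeriesTerm u (q ^ n) r / (1 + q ^ (n * (r - 1) + a)) *
      x ^ (n * (r - 1) + a) := by
  refine Summable.of_norm ?_
  simpa only [norm_mul, norm_zpow] using
    summable_appellLaurent_aux hq0 hq1 hu hn a (norm_pos_iff.2 hx)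

theorem differentiableOn_appellLaurent :
    DifferentiableOn ℂ (appellLaurent q u n a) {0}ᶜ := by
  refine differentiableOn_of_annulus fun α β hα => ?_
  rcases le_or_gt β 0 with hβ | hβ
  · intro x hx
    exact absurd (hα.trans (hx.1.trans hx.2)) hβ.not_gt
  -- On `α < |x| < β` the power `|x|^k` is at most `β^k` or `α^k` according to the sign of `k`, so
  -- the two boundary series together dominate.
  refine Complex.differentiableOn_tsum_of_summable_norm
    ((summable_appellLaurent_aux hq0 hq1 hu hn a hα).add
      (summable_appellLaurent_aux hq0 hq1 hu hn a hβ)) (fun r => ?_) (isOpen_annulus α β)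
      fun r x hx => ?_
  · exact (differentiableOn_id.zpow (Or.inl fun x hx => norm_pos_iff.1 (hα.trans hx.1))).const_mul _
  · rw [norm_mul, norm_zpow, ← mul_add]
    gcongr
    have h0 := hα.trans hx.1
    generalize (n * (r - 1) + a) = k
    rcases le_total 0 k with hk | hk
    · have h1 : ‖x‖ ^ k ≤ β ^ k := zpow_le_zpow_left₀ hk h0.le hx.2.le
      have h2 : 0 < α ^ k := by positivity
      linarith
    · have h1 : ‖x‖ ^ k ≤ α ^ k := by
        obtain ⟨j, rfl⟩ : ∃ j : ℕ, k = -j := ⟨(-k).toNat, by omega⟩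
        rw [zpow_neg, zpow_neg, zpow_natCast, zpow_natCast]
        gcongr
        exact hx.1.le
      have h2 : 0 < β ^ k := by positivity
      linarith

theorem appellLaurent_mul_left_add {x : ℂ} (hx : x ≠ 0) :
    appellLaurent q u n a (q * x) + appellLaurent q u n a x =
      x ^ (a - n) * bigTheta (u * x ^ n) (q ^ n) := by
  have hQ1 : ‖q ^ n‖ < 1 := by
    rw [norm_pow]; exact pow_lt_one₀ (norm_nonneg q) hq1 hn
  rw [bigTheta_eq_tsum (pow_ne_zero n hq0) hQ1 (mul_ne_zero hu (pow_ne_zero n hx)), appellLaurent,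
    appellLaurent, ← Summable.tsum_add (summable_appellLaurent hq0 hq1 hu hn a
      (mul_ne_zero hq0 hx)) (summable_appellLaurent hq0 hq1 hu hn a hx), ← tsum_mul_left]
  refine tsum_congr fun r => ?_
  have h1 := one_add_zpow_ne_zero hq1 (n * (r - 1) + a)
  have h2 : x ^ (n * (r - 1) + a) = (x ^ n) ^ r * x ^ (a - n) := by
    rw [← zpow_natCast x n, ← zpow_mul, ← zpow_add₀ hx]; congr 1; ring
  rw [mul_zpow, h2, thetaSeriesTerm, thetaSeriesTerm, mul_zpow]
  field_simp
  ring

end appellLaurent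

theorem appellLaurent_eq {q u : ℂ} (hq0 : q ≠ 0) {n : ℕ} (a : ℤ) {x X Z : ℂ} (hx : x ≠ 0) (hZ : Z = u * x ^ n) (hXZ : X * Z = -q ^ a)
    (hΘ : bigTheta Z (q ^ n) ≠ 0) :
    appellLaurent q u n a x = x ^ (a - n) * (bigTheta Z (q ^ n) * appellM X Z (q ^ n)) := by
  rw [appellM, ← mul_assoc (bigTheta Z _), mul_one_div_cancel hΘ, one_mul, appellLaurent,
    ← tsum_mul_left]
  refine tsum_congr fun r => ?_
  have h2 : x ^ (n * (r - 1) + a) = (x ^ n) ^ r * x ^ (a - n) := by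
    rw [← zpow_natCast x n, ← zpow_mul, ← zpow_add₀ hx]; congr 1; ring
  have h3 : 1 - (q ^ n) ^ (r - 1) * X * Z = 1 + q ^ (n * (r - 1) + a) := by
    rw [mul_assoc, hXZ, mul_neg, sub_neg_eq_add, ← zpow_natCast, ← zpow_mul, ← zpow_add₀ hq0]
  rw [appellTerm, h3, h2, hZ, thetaSeriesTerm, mul_zpow]
  ring

/-! ### Expansion of a product of two theta functions -/

/-- The rearrangement of `ℤ × ℤ` along the residue of `a + d b` modulo `d + 1`. -/
def residueEquiv (d : ℕ) : Fin (d + 1) × ℤ × ℤ ≃ ℤ × ℤ where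
  toFun v := ((v.1 : ℕ) + v.2.1 - d * v.2.2, v.2.2 + v.2.1)
  invFun w := ((Int.divModEquiv (d + 1) (w.1 + d * w.2)).2,
    (Int.divModEquiv (d + 1) (w.1 + d * w.2)).1,
    w.2 - (Int.divModEquiv (d + 1) (w.1 + d * w.2)).1)
  left_inv := by
    rintro ⟨s, r, b⟩
    have h : ((s : ℕ) : ℤ) + r - d * b + d * (b + r) = (Int.divModEquiv (d + 1)).symm (r, s) := by
      rw [Int.divModEquiv_symm_apply]
      push_cast
      ring
    simp only [h, Equiv.apply_symm_apply]
    simp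
  right_inv := by
    rintro ⟨a, b⟩
    have h := (Int.divModEquiv (d + 1)).symm_apply_apply (a + d * b)
    rw [Int.divModEquiv_symm_apply] at h
    set p := Int.divModEquiv (d + 1) (a + d * b)
    push_cast at h
    ext
    · simp only
      linear_combination h
    · simp

theorem two_mul_choose_two (s : ℕ) : 2 * ((s.choose 2 : ℕ) : ℤ) = s * (s - 1) := by
  induction s with
  | zero => simp
  | succ s ih =>
    rw [Nat.choose_succ_succ' s 1, Nat.choose_one_right]
    push_cast
    linear_combination ih

/-- With `d = 2t - 1`, the term of index `(a, b)` in the product of the two series carries `x^{a + d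
b}`. Writing `a + d b = s + 2t r` by division with remainder, the substitution in `residueEquiv`
removes the cross term between `r` and `b` from the exponent of `q`, so each residue `s` contributes
a product of two theta series. -/
theorem bigTheta_mul_bigTheta {x q : ℂ} (hq0 : q ≠ 0) (hq1 : ‖q‖ < 1) (hx : x ≠ 0) {t : ℕ}
    (ht : 1 ≤ t) :
    ∑ s ∈ Finset.range (2 * t), (-1) ^ s * q ^ (s.choose 2) *
        bigTheta (q ^ ((2 * (t : ℤ) - 1) * ((t : ℤ) - s))) (q ^ (2 * t * (2 * t - 1))) *
        x ^ s * bigTheta (q ^ s * x ^ (2 * t)) (q ^ (2 * t)) =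
      bigTheta (-x ^ (2 * t - 1)) (q ^ (2 * t - 1)) * bigTheta x q := by
  obtain ⟨d, hd⟩ : ∃ d, 2 * t = d + 1 := ⟨2 * t - 1, by omega⟩
  have hdz : 2 * (t : ℤ) = d + 1 := by exact_mod_cast hd
  have hd0 : d ≠ 0 := by omega
  rw [hd, Nat.add_sub_cancel, show 2 * (t : ℤ) - 1 = d by rw [hdz]; ring]
  have hpow : ∀ n : ℕ, n ≠ 0 → ‖q ^ n‖ < 1 := fun n hn => by
    rw [norm_pow]; exact pow_lt_one₀ (norm_nonneg q) hq1 hn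
  have hxd : -x ^ d ≠ 0 := neg_ne_zero.2 (pow_ne_zero d hx)
  have sA := summable_norm_thetaSeriesTerm hq0 hq1 hx
  have sB := summable_norm_thetaSeriesTerm (pow_ne_zero d hq0) (hpow d hd0) hxd
  have hA := (hasSum_thetaSeriesTerm hq0 hq1 hx).mul
    (hasSum_thetaSeriesTerm (pow_ne_zero d hq0) (hpow d hd0) hxd)
    (summable_mul_of_summable_norm sA sB)
  have key : ∀ (s : ℕ) (r b : ℤ),
      thetaSeriesTerm x q (s + r - d * b) * thetaSeriesTerm (-x ^ d) (q ^ d) (b + r) =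
        (-1) ^ s * q ^ (s.choose 2) * x ^ s *
          (thetaSeriesTerm (q ^ s * x ^ (d + 1)) (q ^ (d + 1)) r *
            thetaSeriesTerm (q ^ ((d : ℤ) * (t - s))) (q ^ ((d + 1) * d)) b) := by
    intro s r b
    have hm1 : (-1 : ℂ) ≠ 0 := by norm_num
    -- The minus sign in `-x^d` doubles `(-1)^{b+r}` to `1`, and oddness of `d` gives `(-1)^{db} =
    -- (-1)^b`.
    have hs1 : (-1 : ℂ) ^ (s + r - d * b) * ((-1) ^ (b + r) * (-1) ^ (b + r)) =
        (-1) ^ (s : ℤ) * ((-1) ^ r * (-1) ^ b) := by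
      have hdb : (d : ℤ) * b = 2 * (t * b) - b := by linear_combination -b * hdz
      have h2 : ∀ k : ℤ, (-1 : ℂ) ^ (2 * k) = 1 := fun k => by rw [zpow_mul]; norm_num
      rw [← zpow_add₀ hm1, ← zpow_add₀ hm1, ← zpow_add₀ hm1, ← zpow_add₀ hm1,
        show (s : ℤ) + r - d * b + (b + r + (b + r)) = (s + (r + b)) + 2 * (b + r - t * b) by
          rw [hdb]; ring, zpow_add₀ hm1, h2, mul_one]
    have hneg : (-x ^ d) ^ (b + r) = (-1) ^ (b + r) * x ^ ((d : ℤ) * (b + r)) := by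
      rw [← neg_one_mul, mul_zpow, zpow_mul, zpow_natCast]
    have hL : thetaSeriesTerm x q (s + r - d * b) * thetaSeriesTerm (-x ^ d) (q ^ d) (b + r) =
        ((-1 : ℂ) ^ (s + r - d * b) * ((-1) ^ (b + r) * (-1) ^ (b + r))) *
        q ^ ((s + r - d * b) * (s + r - d * b - 1) / 2 + d * ((b + r) * (b + r - 1) / 2)) *
        x ^ (s + r - d * b + d * (b + r)) := by
      rw [thetaSeriesTerm, thetaSeriesTerm, hneg, zpow_add₀ hq0, zpow_add₀ hx, ← zpow_natCast q d,
        ← zpow_mul q]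
      ring
    have hR : (-1) ^ s * q ^ (s.choose 2) * x ^ s *
          (thetaSeriesTerm (q ^ s * x ^ (d + 1)) (q ^ (d + 1)) r *
            thetaSeriesTerm (q ^ ((d : ℤ) * (t - s))) (q ^ ((d + 1) * d)) b) =
        ((-1) ^ (s : ℤ) * ((-1) ^ r * (-1) ^ b)) *
        q ^ ((s.choose 2 : ℤ) + ((d + 1) * (r * (r - 1) / 2) + s * r +
          ((d + 1) * d * (b * (b - 1) / 2) + d * (t - s) * b))) *
        x ^ (s + (d + 1) * r) := by
      have hn : ∀ (y : ℂ) (n : ℕ) (k : ℤ), (y ^ n) ^ k = y ^ ((n : ℤ) * k) := fun y n k => by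
        rw [zpow_mul, zpow_natCast]
      simp only [thetaSeriesTerm, mul_zpow, hn, ← zpow_mul]
      push_cast
      simp only [zpow_add₀ hq0, zpow_add₀ hx, zpow_natCast]
      ring
    rw [hL, hR, hs1]
    congr 2
    · congr 1
      apply mul_left_cancel₀ (two_ne_zero' ℤ)
      have e1 := two_mul_tri (s + r - d * b)
      have e2 := two_mul_tri (b + r)
      have e3 := two_mul_tri r
      have e4 := two_mul_tri b
      have e5 := two_mul_choose_two s
      linear_combination e1 + d * e2 - (d + 1) * e3 - (d + 1) * d * e4 - e5 - d * b * hdz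
    · ring
  have hB := ((residueEquiv d).hasSum_iff.2 hA)
  rw [mul_comm (bigTheta (-x ^ d) _), ← hB.tsum_eq, hB.summable.tsum_prod, tsum_fintype, Finset.sum_range]
  refine Finset.sum_congr rfl fun s _ => ?_
  simp only [Function.comp_apply, residueEquiv, Equiv.coe_fn_mk, key]
  rw [tsum_mul_left, ← tsum_mul_tsum_of_summable_norm
    (summable_norm_thetaSeriesTerm (pow_ne_zero _ hq0) (hpow _ d.succ_ne_zero)
      (mul_ne_zero (pow_ne_zero _ hq0) (pow_ne_zero _ hx)))
    (summable_norm_thetaSeriesTerm (pow_ne_zero _ hq0)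
      (hpow _ (mul_ne_zero d.succ_ne_zero hd0)) (zpow_ne_zero _ hq0)),
    ← bigTheta_eq_tsum (pow_ne_zero _ hq0) (hpow _ d.succ_ne_zero)
      (mul_ne_zero (pow_ne_zero _ hq0) (pow_ne_zero _ hx)),
    ← bigTheta_eq_tsum (pow_ne_zero _ hq0)
      (hpow _ (mul_ne_zero d.succ_ne_zero hd0)) (zpow_ne_zero _ hq0)]
  ring

/-! ### The Hecke-type double sum in separated coordinates -/

theorem sg_sub_sg_sub_one (k : ℤ) : sg k - sg (k - 1) = if k = 0 then 2 else 0 := by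
  unfold sg
  split_ifs <;> first | omega | norm_num

theorem norm_sg₂_le (r s : ℤ) : ‖sg₂ r s‖ ≤ 1 := by
  unfold sg₂ sg
  split_ifs <;> norm_num

theorem mul_nonneg_of_sg₂_ne_zero {r s : ℤ} (h : sg₂ r s ≠ 0) : 0 ≤ r * s := by
  unfold sg₂ sg at h
  split_ifs at h with h1 h2 h2
  · exact mul_nonneg h1 h2
  · norm_num at h
  · norm_num at h
  · exact mul_nonneg_of_nonpos_of_nonpos (by omega) (by omega)

/-- Pairs of integers of equal parity, parametrized by half sum and half difference. -/
def evenPairEquiv : EvenPair ≃ ℤ × ℤ where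
  toFun v := ((v.1.1 + v.1.2) / 2, (v.1.1 - v.1.2) / 2)
  invFun w := ⟨(w.1 + w.2, w.1 - w.2), by
    rw [Int.modEq_iff_dvd]; exact ⟨-w.2, by ring⟩⟩
  left_inv := by
    rintro ⟨⟨r, s⟩, h⟩
    have h' : r % 2 = s % 2 := h
    ext <;> simp only <;> omega
  right_inv := by
    rintro ⟨n, j⟩
    ext <;> simp only <;> omega

/-- The coefficients `(-1) ^ j q ^ (-(2t-1) j (j-1) / 2 - m j)` of the inner sum. -/
def innerCoeff (t m : ℤ) (q : ℂ) (j : ℤ) : ℂ :=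
  (-1) ^ j * q ^ (-((2 * t - 1) * (j * (j - 1) / 2)) - m * j)

/-- The summand of the indefinite theta series in the coordinates of `evenPairEquiv`. -/
def heckeTerm (t m : ℤ) (q : ℂ) (l : ℤ) (w : ℤ × ℤ) : ℂ :=
  sg₂ (w.1 + w.2) (w.1 - w.2) * innerCoeff t m q w.2 * q ^ (t * w.1 ^ 2 + l * w.1)

/-- The finite inner sum of the indefinite theta series. -/
def heckeCoeff (t m : ℤ) (q : ℂ) (n : ℤ) : ℂ :=
  ∑' j : ℤ, sg₂ (n + j) (n - j) * innerCoeff t m q j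

/-- The coefficients `A n q ^ (t n ^ 2 + l n)` with `A = heckeCoeff t m q`. -/
def heckeRow (t m : ℤ) (q : ℂ) (l n : ℤ) : ℂ := heckeCoeff t m q n * q ^ (t * n ^ 2 + l * n)

/-- In these coordinates the quadratic form is diagonal, and raising both parameters by `k` only
inserts `q^{kn}`. This is why exactly the values `θ_{t+k,m+k}` occur. -/
theorem expB_add (t k m n j : ℤ) : expB t (t + k) (m + k) (n + j) (n - j) =
    -((2 * t - 1) * (j * (j - 1) / 2)) - m * j + (t * n ^ 2 + (t + k) * n) := by
  refine Int.ediv_eq_of_eq_mul_right (by norm_num) ?_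
  unfold eightB
  linear_combination 4 * (2 * t - 1) * two_mul_tri j

theorem thetaTerm_evenPairEquiv_symm {q : ℂ} (hq0 : q ≠ 0) (t : ℕ) (k m : ℤ) (w : ℤ × ℤ) :
    thetaTerm t (t + k) (m + k) q (evenPairEquiv.symm w) = heckeTerm t m q (t + k) w := by
  obtain ⟨n, j⟩ := w
  simp only [thetaTerm, evenPairEquiv, Equiv.coe_fn_symm_mk, expB_add, heckeTerm, innerCoeff]
  rw [show (n + j - (n - j)) / 2 = j by omega, zpow_add₀ hq0]
  ring

theorem gTerm_evenPairEquiv_symm {x q : ℂ} (hq0 : q ≠ 0) (t : ℕ) (m : ℤ) (w : ℤ × ℤ) :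
    gTerm t m x q (evenPairEquiv.symm w) = heckeTerm t m q t w / (1 - x * q ^ w.1) := by
  have h := thetaTerm_evenPairEquiv_symm hq0 t 0 m w
  rw [add_zero, add_zero] at h
  rw [← h]
  obtain ⟨n, j⟩ := w
  simp only [thetaTerm, gTerm, evenPairEquiv, Equiv.coe_fn_symm_mk]
  rw [show (n + j + (n - j)) / 2 = n by omega]
  ring

section

variable {q : ℂ} {t : ℤ} (m : ℤ)

/-- The form is indefinite, but `sg₂` restricts the sum to `n² ≥ j²`. Four times the exponent equals
`n² + 4ln + j² + (4t-2-4m)j + (4t-1)(n² - j²)`, so with `ρ = |q|^{1/4}` a product of two Gaussian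
series dominates. -/
theorem summable_heckeTerm (hq0 : q ≠ 0) (hq1 : ‖q‖ < 1) (ht : 1 ≤ t) (l : ℤ) :
    Summable (heckeTerm t m q l) := by
  have hqp := norm_pos_iff.2 hq0
  obtain ⟨ρ, hρ0, hρ⟩ : ∃ ρ : ℝ, 0 < ρ ∧ ρ ^ 4 = ‖q‖ :=
    ⟨‖q‖ ^ (1 / 4 : ℝ), by positivity, by
      rw [← Real.rpow_natCast, ← Real.rpow_mul hqp.le]; norm_num⟩
  have hρ1 : ρ < 1 := by
    by_contra h
    have := one_le_pow₀ (n := 4) (not_lt.1 h)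
    linarith
  have hg : ∀ k : ℤ, Summable fun n : ℤ => ρ ^ (n ^ 2 + k * n) := fun k => by
    refine (summable_gauss (pow_pos hρ0 2) (pow_lt_one₀ hρ0.le hρ1 two_ne_zero)
      (zpow_pos hρ0 (k + 1))).congr fun n => ?_
    rw [← zpow_natCast ρ 2, ← zpow_mul, ← zpow_mul, ← zpow_add₀ hρ0.ne']
    congr 1
    push_cast
    linear_combination two_mul_tri n
  refine Summable.of_norm_bounded ((hg (4 * l)).mul_of_nonneg (hg (4 * t - 2 - 4 * m))
    (fun n => by positivity) (fun n => by positivity)) fun ⟨n, j⟩ => ?_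
  simp only [heckeTerm, innerCoeff]
  by_cases h : sg₂ (n + j) (n - j) = 0
  · rw [h, zero_mul, zero_mul, norm_zero]
    positivity
  have h0 := mul_nonneg_of_sg₂_ne_zero h
  rw [norm_mul, norm_mul, norm_mul, norm_neg_one_zpow, one_mul, norm_zpow, norm_zpow]
  calc _ ≤ 1 * ‖q‖ ^ (-((2 * t - 1) * (j * (j - 1) / 2)) - m * j) *
        ‖q‖ ^ (t * n ^ 2 + l * n) := by
        gcongr
        exact norm_sg₂_le _ _
    _ = ρ ^ (4 * (-((2 * t - 1) * (j * (j - 1) / 2)) - m * j + (t * n ^ 2 + l * n))) := by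
        rw [one_mul, ← zpow_add₀ hqp.ne', ← hρ, zpow_mul]
        norm_cast
    _ ≤ ρ ^ (n ^ 2 + 4 * l * n + (j ^ 2 + (4 * t - 2 - 4 * m) * j)) := by
        refine zpow_le_zpow_right_of_le_one₀ hρ0 hρ1.le ?_
        have h2 := two_mul_tri j
        have h3 : 0 ≤ (4 * t - 1) * ((n + j) * (n - j)) := mul_nonneg (by omega) h0
        nlinarith
    _ = _ := zpow_add₀ hρ0.ne' _ _

theorem hasSum_heckeCoeff (hq0 : q ≠ 0) (hq1 : ‖q‖ < 1) (ht : 1 ≤ t) (n : ℤ) :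
    HasSum (fun j => sg₂ (n + j) (n - j) * innerCoeff t m q j) (heckeCoeff t m q n) := by
  have h : Summable fun j => heckeTerm t m q 0 (n, j) :=
    (summable_heckeTerm m hq0 hq1 ht 0).prod_factor n
  simp only [heckeTerm] at h
  rw [summable_mul_right_iff (zpow_ne_zero _ hq0)] at h
  exact h.hasSum

/-- Between `n - 1` and `n` the sign factor jumps only where `n + j = 0` or `n - j = 0`, by `1` for
each condition; at `n = 0` the two coincide and count twice. -/
theorem heckeCoeff_sub (hq0 : q ≠ 0) (hq1 : ‖q‖ < 1) (ht : 1 ≤ t) (n : ℤ) :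
    heckeCoeff t m q (n - 1) =
      heckeCoeff t m q n - innerCoeff t m q n - innerCoeff t m q (-n) := by
  have h := (hasSum_heckeCoeff m hq0 hq1 ht n).sub (hasSum_heckeCoeff m hq0 hq1 ht (n - 1))
  have h2 := (hasSum_ite_eq n (innerCoeff t m q n)).add
    (hasSum_ite_eq (-n) (innerCoeff t m q (-n)))
  have h3 : (fun j => sg₂ (n + j) (n - j) * innerCoeff t m q j -
      sg₂ (n - 1 + j) (n - 1 - j) * innerCoeff t m q j) =
      fun j => (if j = n then innerCoeff t m q n else 0) +
        (if j = -n then innerCoeff t m q (-n) else 0) := by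
    funext j
    have e1 := sg_sub_sg_sub_one (n + j)
    have e2 := sg_sub_sg_sub_one (n - j)
    have e3 : sg₂ (n + j) (n - j) * innerCoeff t m q j -
        sg₂ (n - 1 + j) (n - 1 - j) * innerCoeff t m q j =
        ((sg (n + j) - sg (n + j - 1)) + (sg (n - j) - sg (n - j - 1))) / 2 *
          innerCoeff t m q j := by
      rw [sg₂, sg₂, show n - 1 + j = n + j - 1 by ring, show n - 1 - j = n - j - 1 by ring]
      ring
    rw [e3, e1, e2, add_div, add_mul, add_comm]
    congr 1
    · by_cases h : j = n
      · subst h; simp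
      · simp [h, sub_eq_zero, Ne.symm h]
    · by_cases h : j = -n
      · subst h; simp
      · have : n + j ≠ 0 := fun h' => h (by omega)
        simp [h, this]
  rw [h3] at h
  linear_combination -(h.unique h2)

theorem hasSum_heckeTerm_row (hq0 : q ≠ 0) (hq1 : ‖q‖ < 1) (ht : 1 ≤ t) (l n : ℤ) :
    HasSum (fun j => heckeTerm t m q l (n, j)) (heckeRow t m q l n) := by
  simpa only [heckeTerm, heckeRow] using
    (hasSum_heckeCoeff m hq0 hq1 ht n).mul_right (q ^ (t * n ^ 2 + l * n))

theorem hasSum_heckeRow (hq0 : q ≠ 0) (hq1 : ‖q‖ < 1) (ht : 1 ≤ t) (l : ℤ) :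
    HasSum (heckeRow t m q l) (∑' w, heckeTerm t m q l w) :=
  (summable_heckeTerm m hq0 hq1 ht l).hasSum.prod_fiberwise
    (hasSum_heckeTerm_row m hq0 hq1 ht l)

/-- At `j = ±n` the quadratic part `-(2t-1)n²/2` of the inner exponent cancels all but `n²/2` of `t
n²`, leaving level-one coefficients. -/
theorem heckeCoeff_sub_one_mul (hq0 : q ≠ 0) (hq1 : ‖q‖ < 1) (ht : 1 ≤ t) (l n : ℤ) :
    heckeCoeff t m q (n - 1) * q ^ (t * n ^ 2 + l * n) =
      heckeRow t m q l n - appellCoeff q (l + t - m) n - appellCoeff q (l + m + 1 - t) n := by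
  have h1 : innerCoeff t m q n * q ^ (t * n ^ 2 + l * n) = appellCoeff q (l + t - m) n := by
    rw [innerCoeff, appellCoeff, thetaSeriesTerm, mul_assoc, ← zpow_add₀ hq0, ← zpow_mul,
      mul_assoc, ← zpow_add₀ hq0]
    congr 2
    linear_combination -t * two_mul_tri n
  have h2 : innerCoeff t m q (-n) * q ^ (t * n ^ 2 + l * n) =
      appellCoeff q (l + m + 1 - t) n := by
    rw [innerCoeff, appellCoeff, thetaSeriesTerm, mul_assoc, ← zpow_add₀ hq0, ← zpow_mul,
      mul_assoc, ← zpow_add₀ hq0, tri_neg, zpow_neg, ← inv_zpow, inv_neg_one]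
    congr 2
    linear_combination -t * two_mul_tri n
  rw [heckeCoeff_sub m hq0 hq1 ht, ← h1, ← h2, heckeRow]
  ring

theorem heckeRow_sub_one (hq0 : q ≠ 0) (hq1 : ‖q‖ < 1) (ht : 1 ≤ t) (l n : ℤ) :
    q ^ (t + l) * heckeRow t m q (l + 2 * t) (n - 1) =
      heckeRow t m q l n - appellCoeff q (l + t - m) n - appellCoeff q (l + m + 1 - t) n := by
  rw [← heckeCoeff_sub_one_mul m hq0 hq1 ht, heckeRow, mul_left_comm, ← zpow_add₀ hq0]
  congr 2
  ring

/-- Summing the row recursion over `n`, both boundary contributions vanish as values of `Θ` at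
powers of `q`. -/
theorem tsum_heckeTerm_eq (hq0 : q ≠ 0) (hq1 : ‖q‖ < 1) (ht : 1 ≤ t) (l : ℤ) :
    ∑' w, heckeTerm t m q l w = q ^ (t + l) * ∑' w, heckeTerm t m q (l + 2 * t) w := by
  have h1 := ((Equiv.subRight (1 : ℤ)).hasSum_iff.2
    (hasSum_heckeRow m hq0 hq1 ht (l + 2 * t))).mul_left (q ^ (t + l))
  simp only [Function.comp_apply, Equiv.subRight_apply, heckeRow_sub_one m hq0 hq1 ht] at h1
  have h2 := ((hasSum_heckeRow m hq0 hq1 ht l).sub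
    (summable_appellCoeff hq0 hq1 (l + t - m)).hasSum).sub
    (summable_appellCoeff hq0 hq1 (l + m + 1 - t)).hasSum
  rw [tsum_appellCoeff hq0 hq1, tsum_appellCoeff hq0 hq1, sub_zero, sub_zero] at h2
  exact h2.unique h1

theorem thetaAppell_heckeRow_eq_add (hq0 : q ≠ 0) (hq1 : ‖q‖ < 1) (ht : 1 ≤ t) {x : ℂ}
    (hx : x ≠ 0) (l : ℤ) (j : ℕ) :
    thetaAppell q (heckeRow t m q l) x = x ^ j * thetaAppell q (heckeRow t m q (l + j)) x +
      bigTheta x q * ∑ k ∈ Finset.range j, x ^ k * ∑' w, heckeTerm t m q (l + k) w := by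
  induction j with
  | zero => simp
  | succ j ih =>
    have h : (fun n => heckeRow t m q (l + j) n * q ^ n) = heckeRow t m q (l + (j + 1 : ℕ)) := by
      funext n
      rw [heckeRow, heckeRow, mul_assoc, ← zpow_add₀ hq0]
      congr 2
      push_cast
      ring
    rw [ih, thetaAppell_eq_add hq0 hq1 hx (hasSum_heckeRow m hq0 hq1 ht (l + j)).summable
      (h ▸ (hasSum_heckeRow m hq0 hq1 ht _).summable), h,
      (hasSum_heckeRow m hq0 hq1 ht (l + j)).tsum_eq, Finset.sum_range_succ]
    ring

end

/-! ### The functional equation of `Θ g` -/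

/-- The functional equation of `Θ(x; q) * g_{t,m}(x)`. -/
theorem thetaAppell_heckeRow_mul_left {q : ℂ} (hq0 : q ≠ 0) (hq1 : ‖q‖ < 1) {t m : ℕ}
    (ht : 1 ≤ t) (hm : m ≤ 2 * t) {x : ℂ} (hx : x ≠ 0) :
    thetaAppell q (heckeRow t m q t) (q * x) = -x⁻¹ *
      (x ^ (2 * t) * thetaAppell q (heckeRow t m q t) x +
        bigTheta x q * ∑ k ∈ Finset.range (2 * t),
          x ^ k * q ^ k * ∑' w, heckeTerm t m q (t + k) w -
        x ^ (m + 1) * qPochInf q q ^ 3 - x ^ (2 * t - m) * qPochInf q q ^ 3) := by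
  have ht' : (1 : ℤ) ≤ t := by exact_mod_cast ht
  have h1 : (fun n => heckeRow (t : ℤ) m q t (n - 1)) = fun n => heckeRow (t : ℤ) m q (-t) n -
      appellCoeff q (1 - (m + 1 : ℕ)) n - appellCoeff q (1 - (2 * t - m : ℕ)) n := by
    funext n
    -- The choice `l = -t` makes the prefactor `q^{t+l}` trivial and `l + 2t = t`. Raising `l` back
    -- from `-t` to `t` then takes `2t` applications of `thetaAppell_eq_add`.
    have := heckeRow_sub_one (m : ℤ) hq0 hq1 ht' (-t) n
    rw [add_neg_cancel, zpow_zero, one_mul, show -(t : ℤ) + 2 * t = t by ring] at this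
    rw [this]
    congr 2
    · congr 1; push_cast; ring
    · rw [Nat.cast_sub hm]; push_cast; ring
  have hs := fun l : ℤ =>
    summable_thetaAppell hq0 hq1 hx (hasSum_heckeRow (m : ℤ) hq0 hq1 ht' l).summable
  have hs' := fun l : ℤ => summable_thetaAppell hq0 hq1 hx (summable_appellCoeff hq0 hq1 l)
  have h2 : thetaAppell q (fun n => heckeRow (t : ℤ) m q (-t) n -
      appellCoeff q (1 - (m + 1 : ℕ)) n - appellCoeff q (1 - (2 * t - m : ℕ)) n) x =
      thetaAppell q (heckeRow (t : ℤ) m q (-t)) x -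
        thetaAppell q (appellCoeff q (1 - (m + 1 : ℕ))) x -
        thetaAppell q (appellCoeff q (1 - (2 * t - m : ℕ))) x := by
    simp only [thetaAppell, sub_mul]
    rw [((hs _).sub (hs' _)).tsum_sub (hs' _), (hs _).tsum_sub (hs' _)]
  rw [thetaAppell_mul_left hq0 hx, h1, h2, thetaAppell_appellCoeff hq0 hq1 hx,
    thetaAppell_appellCoeff hq0 hq1 hx,
    thetaAppell_heckeRow_eq_add (m : ℤ) hq0 hq1 ht' hx (-t) (2 * t)]
  rw [show -(t : ℤ) + (2 * t : ℕ) = t by push_cast; ring]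
  congr 5
  refine Finset.sum_congr rfl fun k _ => ?_
  rw [tsum_heckeTerm_eq (m : ℤ) hq0 hq1 ht' (-t + k), add_neg_cancel_left, zpow_natCast,
    show -(t : ℤ) + k + 2 * t = t + k by ring]
  ring

/-! ### Return to the series over pairs of equal parity -/

theorem summable_thetaTerm {q : ℂ} (hq0 : q ≠ 0) (hq1 : ‖q‖ < 1) {t : ℕ} (ht : 1 ≤ t)
    (k m : ℤ) : Summable (thetaTerm t (t + k) (m + k) q) := by
  refine evenPairEquiv.symm.summable_iff.1 ?_
  refine (summable_heckeTerm (t := (t : ℤ)) m hq0 hq1 (by exact_mod_cast ht) (t + k)).congr fun w => ?_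
  rw [Function.comp_apply, thetaTerm_evenPairEquiv_symm hq0]

theorem thetaPM_eq {q : ℂ} (hq0 : q ≠ 0) (t : ℕ) (k m : ℤ) :
    thetaPM t (t + k) (m + k) q = ∑' w, heckeTerm t m q (t + k) w := by
  rw [thetaPM, ← evenPairEquiv.symm.tsum_eq]
  exact tsum_congr fun w => thetaTerm_evenPairEquiv_symm hq0 t k m w

theorem summable_heckeTerm_div {x q : ℂ} (hq0 : q ≠ 0) (hq1 : ‖q‖ < 1) {t : ℤ} (ht : 1 ≤ t)
    (m : ℤ) (hx : x ≠ 0) (h : ∀ n : ℤ, 1 - x * q ^ n ≠ 0) :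
    Summable fun w : ℤ × ℤ => heckeTerm t m q t w / (1 - x * q ^ w.1) := by
  obtain ⟨δ, hδ, hδ'⟩ := exists_le_norm_one_sub hq0 hq1 hx h
  refine Summable.of_norm_bounded
    ((summable_heckeTerm m hq0 hq1 ht t).norm.mul_right δ⁻¹) fun w => ?_
  rw [norm_div, div_eq_mul_inv]
  gcongr
  exact hδ' w.1

theorem summable_gTerm {x q : ℂ} (hq0 : q ≠ 0) (hq1 : ‖q‖ < 1) {t : ℕ} (ht : 1 ≤ t) (m : ℤ)
    (hx : x ≠ 0) (h : ∀ n : ℤ, 1 - x * q ^ n ≠ 0) : Summable (gTerm t m x q) := by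
  refine evenPairEquiv.symm.summable_iff.1 ?_
  refine (summable_heckeTerm_div (t := (t : ℤ)) hq0 hq1 (by exact_mod_cast ht) m hx h).congr fun w => ?_
  rw [Function.comp_apply, gTerm_evenPairEquiv_symm hq0]

theorem bigTheta_mul_gTM {x q : ℂ} (hq0 : q ≠ 0) (hq1 : ‖q‖ < 1) {t : ℕ} (ht : 1 ≤ t) (m : ℤ)
    (hx : x ≠ 0) (h : ∀ n : ℤ, 1 - x * q ^ n ≠ 0) :
    bigTheta x q * gTM t m x q = thetaAppell q (heckeRow t m q t) x := by
  have ht' : (1 : ℤ) ≤ t := by exact_mod_cast ht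
  have h1 : gTM t m x q = ∑' w : ℤ × ℤ, heckeTerm t m q t w / (1 - x * q ^ w.1) := by
    rw [gTM, ← evenPairEquiv.symm.tsum_eq]
    exact tsum_congr fun w => gTerm_evenPairEquiv_symm hq0 t m w
  have h2 := (summable_heckeTerm_div hq0 hq1 ht' m hx h).hasSum.prod_fiberwise
    fun n => (hasSum_heckeTerm_row m hq0 hq1 ht' t n).div_const (1 - x * q ^ n)
  rw [h1, ← h2.tsum_eq, thetaAppell, ← tsum_mul_left]
  refine tsum_congr fun n => ?_
  rw [← one_sub_mul_thetaOver hq0 hq1 hx n]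
  field_simp [h n]

/-! ### Uniqueness and the final identity -/

/-- Multiplying by `T` and writing the Appell functions as Laurent series leaves no poles on the
right, so the comparison can run over the whole punctured plane, with `G` replacing `Θ g` on the
left. -/
theorem bigTheta_mul_fTM {q : ℂ} (hq0 : q ≠ 0) (hq1 : ‖q‖ < 1) {t m : ℕ} (ht : 1 ≤ t)
    (hm : m < 2 * t) {x : ℂ} (hx : x ≠ 0) (h : ∀ n : ℤ, 1 - x * q ^ n ≠ 0) :
    bigTheta (-x ^ (2 * t - 1)) (q ^ (2 * t - 1)) * fTM t m x q =
      appellLaurent q (-1) (2 * t - 1) m x +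
      appellLaurent q (-1) (2 * t - 1) (2 * t - 1 - m : ℕ) x -
      (qPochInf q q ^ 3)⁻¹ * ∑ k ∈ Finset.range (2 * t), q ^ k * thetaPM t (t + k) (m + k) q *
        ∑ s ∈ Finset.range (2 * t), (-1) ^ s * q ^ (s.choose 2) *
          bigTheta (q ^ ((2 * (t : ℤ) - 1) * ((t : ℤ) - s))) (q ^ (2 * t * (2 * t - 1))) *
          appellLaurent q (q ^ s) (2 * t) (k + s) x := by
  have ht' : (1 : ℤ) ≤ t := by exact_mod_cast ht
  have hd : 2 * t - 1 ≠ 0 := by omega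
  have h2t : 2 * t ≠ 0 := by omega
  have hP : qPochInf q q ^ 3 ≠ 0 := pow_ne_zero 3 (qPochInf_self_ne_zero hq1)
  have hQ1 : ‖q ^ (2 * t - 1)‖ < 1 := by
    rw [norm_pow]; exact pow_lt_one₀ (norm_nonneg q) hq1 hd
  have hQ0 : q ^ (2 * t - 1) ≠ 0 := pow_ne_zero _ hq0
  set T : ℂ → ℂ := fun y => bigTheta (-y ^ (2 * t - 1)) (q ^ (2 * t - 1)) with hT
  set G : ℂ → ℂ := thetaAppell q (heckeRow t m q t) with hG
  set κ := (qPochInf q q ^ 3)⁻¹ with hκ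
  set c : ℕ → ℂ := fun s => (-1) ^ s * q ^ (s.choose 2) *
    bigTheta (q ^ ((2 * (t : ℤ) - 1) * ((t : ℤ) - s))) (q ^ (2 * t * (2 * t - 1))) with hc
  set θ : ℕ → ℂ := fun k => ∑' w, heckeTerm t m q (t + k) w with hθ
  set H : ℂ → ℂ := fun y => T y * G y * κ - (appellLaurent q (-1) (2 * t - 1) m y +
    appellLaurent q (-1) (2 * t - 1) (2 * t - 1 - m : ℕ) y -
      κ * ∑ k ∈ Finset.range (2 * t), q ^ k * θ k *
        ∑ s ∈ Finset.range (2 * t), c s * appellLaurent q (q ^ s) (2 * t) (k + s) y) with hH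
  have hTd : DifferentiableOn ℂ T {0}ᶜ :=
    (differentiableOn_bigTheta hQ1).comp (by fun_prop) fun y hy => neg_ne_zero.2 (pow_ne_zero _ hy)
  have hHd : DifferentiableOn ℂ H {0}ᶜ := by
    refine ((hTd.mul (differentiableOn_thetaAppell hq0 hq1
      (hasSum_heckeRow (m : ℤ) hq0 hq1 ht' t).summable)).mul_const κ).sub
      (((differentiableOn_appellLaurent hq0 hq1 (by norm_num) hd _).add
      (differentiableOn_appellLaurent hq0 hq1 (by norm_num) hd _)).sub
      (DifferentiableOn.const_mul (DifferentiableOn.fun_sum fun k _ =>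
        DifferentiableOn.const_mul (DifferentiableOn.fun_sum fun s _ =>
          DifferentiableOn.const_mul (differentiableOn_appellLaurent hq0 hq1
            (pow_ne_zero s hq0) h2t _) _) _) _))
  have hfun : ∀ y, y ≠ 0 → H (q * y) = -H y := by
    intro y hy
    -- This multiplier cancels the factor `y^{2t-1}` in the functional equation of `G`, leaving only
    -- the sign `-1`.
    have e1 : T (q * y) = (y ^ (2 * t - 1))⁻¹ * T y := by
      have := bigTheta_mul_left hQ0 hQ1 (neg_ne_zero.2 (pow_ne_zero (2 * t - 1) hy))
      simp only [hT, mul_pow]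
      rw [← mul_neg, this, inv_neg, neg_neg]
    have e2 := thetaAppell_heckeRow_mul_left hq0 hq1 ht hm.le hy
    have e3 := appellLaurent_mul_left_add hq0 hq1 (u := -1) (by norm_num) hd m hy
    have e4 := appellLaurent_mul_left_add hq0 hq1 (u := -1) (by norm_num) hd
      (2 * t - 1 - m : ℕ) hy
    rw [neg_one_mul] at e3 e4
    have e5 : ∀ k : ℕ, ∑ s ∈ Finset.range (2 * t), c s *
          appellLaurent q (q ^ s) (2 * t) (k + s) (q * y) +
        ∑ s ∈ Finset.range (2 * t), c s * appellLaurent q (q ^ s) (2 * t) (k + s) y =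
        y ^ k * (y ^ (2 * t))⁻¹ * (T y * bigTheta y q) := by
      intro k
      rw [← Finset.sum_add_distrib, hT, ← bigTheta_mul_bigTheta hq0 hq1 hy ht, Finset.mul_sum]
      refine Finset.sum_congr rfl fun s _ => ?_
      rw [← mul_add, appellLaurent_mul_left_add hq0 hq1 (pow_ne_zero s hq0) h2t _ hy,
        zpow_sub₀ hy, zpow_add₀ hy, zpow_natCast, zpow_natCast, zpow_natCast]
      ring
    have e6 : ∑ k ∈ Finset.range (2 * t), q ^ k * θ k *
          ∑ s ∈ Finset.range (2 * t), c s * appellLaurent q (q ^ s) (2 * t) (k + s) (q * y) +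
        ∑ k ∈ Finset.range (2 * t), q ^ k * θ k *
          ∑ s ∈ Finset.range (2 * t), c s * appellLaurent q (q ^ s) (2 * t) (k + s) y =
        (y ^ (2 * t))⁻¹ * (T y * bigTheta y q) *
          ∑ k ∈ Finset.range (2 * t), y ^ k * q ^ k * θ k := by
      rw [← Finset.sum_add_distrib, Finset.mul_sum]
      refine Finset.sum_congr rfl fun k _ => ?_
      rw [← mul_add, e5]
      ring
    have e7 : y ^ (2 * t) = y ^ (2 * t - 1) * y := by rw [← pow_succ]; congr 1; omega
    have e8 : y ^ ((m : ℤ) - (2 * t - 1 : ℕ)) = y ^ m * (y ^ (2 * t - 1))⁻¹ := by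
      rw [zpow_sub₀ hy, zpow_natCast, zpow_natCast, div_eq_mul_inv]
    have e9 : y ^ (((2 * t - 1 - m : ℕ) : ℤ) - (2 * t - 1 : ℕ)) * y ^ (2 * t - 1) =
        y ^ (2 * t - 1 - m) := by
      rw [← zpow_natCast y (2 * t - 1), ← zpow_add₀ hy, sub_add_cancel, zpow_natCast]
    have e10 : y ^ (2 * t - m) = y ^ (2 * t - 1 - m) * y := by rw [← pow_succ]; congr 1; omega
    rw [e8] at e3
    have hD := pow_ne_zero (2 * t - 1) hy
    rw [e7] at e2 e6
    rw [e10, ← e9] at e2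
    change G (q * y) = -y⁻¹ * (y ^ (2 * t - 1) * y * G y + bigTheta y q *
      ∑ k ∈ Finset.range (2 * t), y ^ k * q ^ k * θ k - _ - _) at e2
    have e11 : T (q * y) * G (q * y) * κ = -(T y * G y * κ) -
        κ * (((y ^ (2 * t - 1) * y)⁻¹ * (T y * bigTheta y q) *
          ∑ k ∈ Finset.range (2 * t), y ^ k * q ^ k * θ k)) +
        y ^ m * (y ^ (2 * t - 1))⁻¹ * T y +
        y ^ (((2 * t - 1 - m : ℕ) : ℤ) - (2 * t - 1 : ℕ)) * T y := by
      rw [e1, e2]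
      generalize y ^ (((2 * t - 1 - m : ℕ) : ℤ) - (2 * t - 1 : ℕ)) = z
      rw [pow_succ]
      have hκ2 : qPochInf q q ^ 3 = κ⁻¹ := by rw [hκ, inv_inv]
      have hκ3 : κ ≠ 0 := inv_ne_zero hP
      rw [hκ2]
      clear_value κ T G θ
      field_simp
      ring
    simp only [hH]
    linear_combination e11 - e3 - e4 + κ * e6
  -- `H` is constant because its modulus is invariant, and `H(qx) = -H(x)` then forces the constant
  -- to be `0`.
  have hx' : H x = 0 := by
    have h1 := eq_of_norm_eq_mul_left hq0 hq1 hHd (fun y hy => by rw [hfun y hy, norm_neg])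
      (mul_ne_zero hq0 hx) hx
    rw [hfun x hx] at h1
    linear_combination -(1 / 2 : ℂ) * h1
  have hf : fTM t m x q = G x * κ := by
    rw [hG, ← bigTheta_mul_gTM hq0 hq1 ht m hx h, fTM, hκ]
    ring
  simp only [thetaPM_eq hq0]
  rw [hf]
  simp only [hH] at hx'
  linear_combination hx'

theorem theorem1p5 (q : ℂ) (hq0 : q ≠ 0) (hq1 : ‖q‖ < 1)
    (t m : ℕ) (ht : 2 ≤ t) (hm1 : 1 ≤ m) (hmt : m < t)
    (x : ℂ) (hx0 : x ≠ 0)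
    -- `x` is not a zero of `Θ(-x^{2t-1}; q^{2t-1})`
    (hx1 : ∀ n : ℤ, x ^ (2 * t - 1) ≠ -(q ^ (2 * t - 1)) ^ n)
    -- `x` is not a zero of any of the theta functions `Θ(q^s x^{2t}; q^{2t})`, `0 ≤ s ≤ 2t - 1`
    (hx2 : ∀ n : ℤ, x ^ (2 * t) ≠ q ^ n) :
    -- every series and quotient in the identity is meaningful
    (∀ v : EvenPair, 1 - x * q ^ ((v.1.1 + v.1.2) / 2) ≠ 0) ∧
    Summable (gTerm t m x q) ∧
    (∀ k ∈ Finset.range (2 * t), Summable (thetaTerm t (t + k) (m + k) q)) ∧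
    qPochInf q q ≠ 0 ∧
    AppellDefined (x ^ (-2 * (t : ℤ) + 1) * q ^ m) (-x ^ (2 * t - 1)) (q ^ (2 * t - 1)) ∧
    AppellDefined (x ^ (-2 * (t : ℤ) + 1) * q ^ (2 * t - 1 - m)) (-x ^ (2 * t - 1))
      (q ^ (2 * t - 1)) ∧
    (∀ k ∈ Finset.range (2 * t), ∀ s ∈ Finset.range (2 * t),
      AppellDefined (-q ^ k * x ^ (-2 * (t : ℤ))) (q ^ s * x ^ (2 * t)) (q ^ (2 * t))) ∧
    -- the identity
    fTM t m x q =
      x ^ (-2 * (t : ℤ) + m + 1) *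
          appellM (x ^ (-2 * (t : ℤ) + 1) * q ^ m) (-x ^ (2 * t - 1)) (q ^ (2 * t - 1))
        + x ^ (-(m : ℤ)) *
          appellM (x ^ (-2 * (t : ℤ) + 1) * q ^ (2 * t - 1 - m)) (-x ^ (2 * t - 1))
            (q ^ (2 * t - 1))
        - x ^ (-2 * (t : ℤ)) /
            (bigTheta (-x ^ (2 * t - 1)) (q ^ (2 * t - 1)) * qPochInf q q ^ 3) *
          ∑ k ∈ Finset.range (2 * t), x ^ k * q ^ k * thetaPM t (t + k) (m + k) q *
            ∑ s ∈ Finset.range (2 * t),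
              (-1) ^ s * q ^ (s.choose 2) *
                bigTheta (q ^ ((2 * (t : ℤ) - 1) * ((t : ℤ) - s))) (q ^ (2 * t * (2 * t - 1))) *
                x ^ s * bigTheta (q ^ s * x ^ (2 * t)) (q ^ (2 * t)) *
                appellM (-q ^ k * x ^ (-2 * (t : ℤ))) (q ^ s * x ^ (2 * t)) (q ^ (2 * t)) := by
  have hd : 2 * t - 1 ≠ 0 := by omega
  have h2t : 2 * t ≠ 0 := by omega
  have ht1 : 1 ≤ t := by omega
  -- A pole `x = q^{-n}` would make `x^{2t}` a power of `q`.
  have hden : ∀ n : ℤ, 1 - x * q ^ n ≠ 0 := by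
    intro n hn
    have e : x = q ^ (-n) := by
      rw [zpow_neg]; exact eq_inv_of_mul_eq_one_left (sub_eq_zero.1 hn).symm
    refine hx2 (-n * (2 * t : ℕ)) ?_
    rw [zpow_mul, ← e, zpow_natCast]
  have hxd : x ^ (-2 * (t : ℤ) + 1) = (x ^ (2 * t - 1))⁻¹ := by
    rw [← zpow_natCast, ← zpow_neg]; congr 1; omega
  have hx2t : x ^ (-2 * (t : ℤ)) = (x ^ (2 * t))⁻¹ := by
    rw [← zpow_natCast, ← zpow_neg]; congr 1
  have hD := pow_ne_zero (2 * t - 1) hx0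
  have hE := pow_ne_zero (2 * t) hx0
  have hmul : ∀ a : ℕ, x ^ (-2 * (t : ℤ) + 1) * q ^ a * -x ^ (2 * t - 1) = -q ^ (a : ℤ) := by
    intro a
    rw [hxd, zpow_natCast]
    field_simp
  have hmul' : ∀ k s : ℕ, -q ^ k * x ^ (-2 * (t : ℤ)) * (q ^ s * x ^ (2 * t)) =
      -q ^ ((k : ℤ) + s) := by
    intro k s
    rw [hx2t, zpow_add₀ hq0, zpow_natCast, zpow_natCast]
    field_simp
  have hdef : ∀ a : ℕ, AppellDefined (x ^ (-2 * (t : ℤ) + 1) * q ^ a) (-x ^ (2 * t - 1))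
      (q ^ (2 * t - 1)) := fun a =>
    appellDefined_of_mul_eq hq0 hq1 hd a (mul_ne_zero (zpow_ne_zero _ hx0) (pow_ne_zero _ hq0))
      (fun k hk => hx1 k (by rw [← hk, neg_neg])) (neg_ne_zero.2 hD) (hmul a)
  have hdef' : ∀ k s : ℕ, AppellDefined (-q ^ k * x ^ (-2 * (t : ℤ))) (q ^ s * x ^ (2 * t))
      (q ^ (2 * t)) := fun k s =>
    appellDefined_of_mul_eq hq0 hq1 h2t _
      (mul_ne_zero (neg_ne_zero.2 (pow_ne_zero _ hq0)) (zpow_ne_zero _ hx0))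
      (fun j hj => hx2 ((2 * t : ℕ) * j - s) (by
        rw [zpow_sub₀ hq0, zpow_mul, zpow_natCast, zpow_natCast, ← hj]
        have := pow_ne_zero s hq0
        field_simp))
      (mul_ne_zero (pow_ne_zero _ hq0) hE) (hmul' k s)
  refine ⟨fun v => hden _, summable_gTerm hq0 hq1 ht1 m hx0 hden,
    fun k _ => summable_thetaTerm hq0 hq1 ht1 k m, qPochInf_self_ne_zero hq1, hdef m, hdef _,
    fun k _ s _ => hdef' k s, ?_⟩
  -- The nonvanishing of `T(x)` does not involve the exponent `a`, so any instance of `hdef`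
  -- supplies it.
  have hT := (hdef 0).1
  have main := bigTheta_mul_fTM hq0 hq1 ht1 (by omega : m < 2 * t) hx0 hden
  rw [appellLaurent_eq hq0 m hx0 (neg_one_mul _).symm (hmul m) hT,
    appellLaurent_eq hq0 (2 * t - 1 - m : ℕ) hx0 (neg_one_mul _).symm (hmul _) hT] at main
  simp only [fun k s : ℕ => appellLaurent_eq hq0 ((k : ℤ) + s) hx0 rfl (hmul' k s)
    (hdef' k s).1] at main
  have e1 : ((m : ℤ) - (2 * t - 1 : ℕ)) = -2 * (t : ℤ) + m + 1 := by omega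
  have e2 : ((2 * t - 1 - m : ℕ) : ℤ) - (2 * t - 1 : ℕ) = -(m : ℤ) := by omega
  rw [e1, e2] at main
  refine mul_left_cancel₀ hT ?_
  rw [main, mul_sub, mul_add]
  congr 1
  · ring
  · rw [← mul_assoc, ← mul_div_assoc, mul_div_mul_left _ _ hT, hx2t, div_eq_inv_mul, mul_assoc,
      Finset.mul_sum, Finset.mul_sum]
    refine Finset.sum_congr rfl fun k _ => ?_
    simp only [Finset.mul_sum]
    refine Finset.sum_congr rfl fun s _ => ?_
    rw [zpow_sub₀ hx0, zpow_add₀ hx0, zpow_natCast, zpow_natCast, zpow_natCast]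
    ring

end
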